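/- Let $p$ be a prime and let $\mathcal G$ be a Hausdorff ample groupoid with non-empty unit space, that is, a topological groupoid with Hausdorff arrow space, whose source map $s:\mathcal G\to\mathcal G^{(0)}$ is a local homeomorphism and whose unit space $\mathcal G^{(0)}$ is locally compact and totally disconnected. For a commutative ring $R$ let $R\mathcal G$ be the Steinberg algebra: the $R$-span of the characteristic functions $\chi_U$ of compact open bisections $U\subseteq\mathcal G$, with the convolution product $(\phi*\psi)(g)=\sum_{s(h)=s(g)}\phi(gh^{-1})\psi(h)$. Let $c_0(\mathcal G,\mathbb Z_p)$ be the module of functions on the set $\mathcal G$ that vanish at infinity, with the supremum norm and the pairing $\langle\xi,\eta\rangle=\sum_{g}\xi(g)\eta(g)$, let $\mathcal B(c_0(\mathcal G,\mathbb Z_p))$ be the algebra of its adjointable bounded $\mathbb Z_p$-linear operators with the operator norm, and let $\mathcal O_p(\mathcal G)\subseteq\mathcal B(c_0(\mathcal G,\mathbb Z_p))$ be the norm closure of the image of $\mathbb Z_p\mathcal G$ under the left regular representation $\lambda(f)\xi=f*\xi$. Then: 1. the $\mathbb F_p$-algebras $\mathcal O_p(\mathcal G)/p\,\mathcal O_p(\mathcal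 G)$ and $\mathbb F_p\mathcal G$ are isomorphic; 2. $\mathcal O_p(\mathcal G)$ is $p$-simple if and only if $\mathcal G$ is effective and minimal. Here an algebra $A$ is called $p$-simple if the algebraic quotient $A/pA$ is a simple $\mathbb F_p$-algebra (its product is not identically zero and its only two-sided ideals are $0$ and itself, which are distinct); $\mathcal G$ is effective if the interior of the isotropy bundle $\{g : s(g)=r(g)\}$ is $\mathcal G^{(0)}$; and $\mathcal G$ is minimal if $\emptyset$ and $\mathcal G^{(0)}$ are the only invariant open subsets of $\mathcal G^{(0)}$. -/

import Mathlib

open CategoryTheory Filter Topology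

universe u v w

namespace GroupoidAlg

/-! ### Topological groupoids

A groupoid is a category all of whose morphisms are invertible; its objects are the units.
An arrow `g : x ⟶ y` has source `x` and range `y`, and the groupoid product `g h`
(defined when the source of `g` is the range of `h`) is the composite `h ≫ g`. -/

/-- The space of all arrows of a groupoid. -/
@[ext]
structure Arr (𝒢 : Type u) [Quiver.{v} 𝒢] where
  /-- the source -/
  src : 𝒢
  /-- the range -/
  tgt : 𝒢
  /-- the arrow itself -/
  hom : src ⟶ tgt

namespace Arr

variable {𝒢 : Type u} [Groupoid.{v} 𝒢]

/-- The unit arrow at an object. -/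
def unit (x : 𝒢) : Arr 𝒢 := ⟨x, x, 𝟙 x⟩

/-- The inverse of an arrow. -/
noncomputable def inv (g : Arr 𝒢) : Arr 𝒢 := ⟨g.tgt, g.src, CategoryTheory.inv g.hom⟩

/-- The product `g h` of two composable arrows. -/
def mul (g h : Arr 𝒢) (e : g.src = h.tgt) : Arr 𝒢 :=
  ⟨h.src, g.tgt, h.hom ≫ eqToHom e.symm ≫ g.hom⟩

end Arr

/-- A topological groupoid: the unit space `𝒢` carries the topology of the set of unit arrows, and
the structure maps are continuous. -/
class TopologicalGroupoid (𝒢 : Type u) [Groupoid.{v} 𝒢] [TopologicalSpace 𝒢]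
    [TopologicalSpace (Arr 𝒢)] : Prop where
  isEmbedding_unit : IsEmbedding (Arr.unit : 𝒢 → Arr 𝒢)
  continuous_src : Continuous (Arr.src : Arr 𝒢 → 𝒢)
  continuous_tgt : Continuous (Arr.tgt : Arr 𝒢 → 𝒢)
  continuous_inv : Continuous (Arr.inv : Arr 𝒢 → Arr 𝒢)
  continuous_mul : Continuous
    (fun q : {q : Arr 𝒢 × Arr 𝒢 // q.1.src = q.2.tgt} => Arr.mul q.1.1 q.1.2 q.2)

/-- An étale groupoid: the source map is a local homeomorphism. -/
class EtaleGroupoid (𝒢 : Type u) [Groupoid.{v} 𝒢] [TopologicalSpace 𝒢]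
    [TopologicalSpace (Arr 𝒢)] : Prop extends TopologicalGroupoid 𝒢 where
  isLocalHomeomorph_src : IsLocalHomeomorph (Arr.src : Arr 𝒢 → 𝒢)

/-- A Hausdorff ample groupoid: an étale groupoid whose arrow space is Hausdorff and whose unit
space is locally compact and totally disconnected. -/
class HausdorffAmpleGroupoid (𝒢 : Type u) [Groupoid.{v} 𝒢] [TopologicalSpace 𝒢]
    [TopologicalSpace (Arr 𝒢)] : Prop extends EtaleGroupoid 𝒢 where
  t2Space_arr : T2Space (Arr 𝒢)
  locallyCompactSpace : LocallyCompactSpace 𝒢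
  totallyDisconnectedSpace : TotallyDisconnectedSpace 𝒢

/-- A groupoid is effective if the interior of its isotropy bundle is the unit space. -/
def IsEffective (𝒢 : Type u) [Groupoid.{v} 𝒢] [TopologicalSpace (Arr 𝒢)] : Prop :=
  interior {g : Arr 𝒢 | g.src = g.tgt} = Set.range Arr.unit

/-- A groupoid is minimal if its unit space has no invariant open subsets other than the empty set
and the whole unit space. -/
def IsMinimal (𝒢 : Type u) [Groupoid.{v} 𝒢] [TopologicalSpace 𝒢] : Prop :=
  ∀ U : Set 𝒢, IsOpen U → (∀ g : Arr 𝒢, g.src ∈ U → g.tgt ∈ U) → U = ∅ ∨ U = Set.univ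

/-- Compact open (local) bisections. -/
structure IsCompactOpenBisection {𝒢 : Type u} [Groupoid.{v} 𝒢] [TopologicalSpace (Arr 𝒢)]
    (U : Set (Arr 𝒢)) : Prop where
  isOpen : IsOpen U
  isCompact : IsCompact U
  injOn_src : Set.InjOn Arr.src U
  injOn_tgt : Set.InjOn Arr.tgt U

/-! ### Convolution -/

/-- The convolution `(φ * ψ)(g) = ∑_{s(h) = s(g)} φ(g h⁻¹) ψ(h)`. -/
noncomputable def conv {R : Type w} [CommRing R] {𝒢 : Type u} [Groupoid.{v} 𝒢]
    (φ ψ : Arr 𝒢 → R) (g : Arr 𝒢) : R :=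
  ∑ᶠ h : (Σ z : 𝒢, (g.src ⟶ z)), φ ⟨h.1, g.tgt, inv h.2 ≫ g.hom⟩ * ψ ⟨g.src, h.1, h.2⟩

/-- The characteristic function of a set of arrows. -/
noncomputable def charFn (R : Type w) [CommRing R] {𝒢 : Type u} [Groupoid.{v} 𝒢]
    (U : Set (Arr 𝒢)) : Arr 𝒢 → R := U.indicator 1

/-- The `R`-module of functions spanned by the characteristic functions of compact open
bisections. -/
def steinbergSpan (R : Type w) [CommRing R] (𝒢 : Type u) [Groupoid.{v} 𝒢]
    [TopologicalSpace (Arr 𝒢)] : Submodule R (Arr 𝒢 → R) :=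
  Submodule.span R {f | ∃ U : Set (Arr 𝒢), IsCompactOpenBisection U ∧ f = charFn R U}

section Helper

variable {R : Type w} [CommRing R] {𝒢 : Type u} [Groupoid.{v} 𝒢]

theorem conv_charFn_of_mem {U : Set (Arr 𝒢)} (hU : Set.InjOn Arr.tgt U) (ξ : Arr 𝒢 → R)
    {x y z : 𝒢} (a : x ⟶ y) (k : z ⟶ y) (hk : (⟨z, y, k⟩ : Arr 𝒢) ∈ U) :
    conv (charFn R U) ξ ⟨x, y, a⟩ = ξ ⟨x, z, a ≫ inv k⟩ := by
  unfold conv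
  rw [finsum_eq_single _ (⟨z, a ≫ inv k⟩ : Σ z : 𝒢, (x ⟶ z))]
  · simp [charFn, hk]
  · rintro ⟨z', h⟩ hne
    have h2 : (⟨z', y, inv h ≫ a⟩ : Arr 𝒢) ∉ U := by
      intro hmem
      have h3 := hU hmem hk rfl
      apply hne
      cases h3
      simp
    simp [charFn, h2]

theorem conv_charFn_of_notMem {U : Set (Arr 𝒢)} (ξ : Arr 𝒢 → R) {x y : 𝒢} (a : x ⟶ y)
    (hn : ¬ ∃ (z : 𝒢) (k : z ⟶ y), (⟨z, y, k⟩ : Arr 𝒢) ∈ U) :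
    conv (charFn R U) ξ ⟨x, y, a⟩ = 0 := by
  unfold conv
  apply finsum_eq_zero_of_forall_eq_zero
  rintro ⟨z', h⟩
  have h2 : (⟨z', y, inv h ≫ a⟩ : Arr 𝒢) ∉ U := fun hmem => hn ⟨_, _, hmem⟩
  simp [charFn, h2]

/-- Finite support on every fibre of the range map. -/
def FinTgt (f : Arr 𝒢 → R) : Prop := ∀ y : 𝒢, {g : Arr 𝒢 | g.tgt = y ∧ f g ≠ 0}.Finite

theorem FinTgt.finite_support {f : Arr 𝒢 → R} (hf : FinTgt f) (ξ : Arr 𝒢 → R) (g : Arr 𝒢) :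
    (Function.support fun h : (Σ z : 𝒢, (g.src ⟶ z)) =>
      f ⟨h.1, g.tgt, inv h.2 ≫ g.hom⟩ * ξ ⟨g.src, h.1, h.2⟩).Finite := by
  have inj : Function.Injective (fun h : (Σ z : 𝒢, (g.src ⟶ z)) =>
      (⟨h.1, g.tgt, inv h.2 ≫ g.hom⟩ : Arr 𝒢)) := by
    rintro ⟨z, h⟩ ⟨z', h'⟩ e
    simp only [Arr.mk.injEq, true_and] at e
    obtain ⟨rfl, e⟩ := e
    have e := eq_of_heq e
    rw [cancel_mono] at e
    have : h = h' := by
      rw [← IsIso.inv_inv (f := h), ← IsIso.inv_inv (f := h')]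
      simp only [e]
    rw [this]
  refine ((hf g.tgt).preimage inj.injOn).subset ?_
  intro h hh
  exact ⟨rfl, left_ne_zero_of_mul hh⟩

theorem FinTgt.of_mem [TopologicalSpace (Arr 𝒢)] {f : Arr 𝒢 → R} (hf : f ∈ steinbergSpan R 𝒢) :
    FinTgt f := by
  induction hf using Submodule.span_induction with
  | mem f hf =>
    obtain ⟨U, hU, rfl⟩ := hf
    intro y
    refine Set.Subsingleton.finite ?_
    rintro a ⟨ha, ha'⟩ b ⟨hb, hb'⟩
    exact hU.injOn_tgt (Set.mem_of_indicator_ne_zero ha') (Set.mem_of_indicator_ne_zero hb')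
      (ha.trans hb.symm)
  | zero => intro y; simp
  | add f g _ _ hf hg =>
    intro y
    refine ((hf y).union (hg y)).subset ?_
    rintro a ⟨ha, ha'⟩
    by_contra hn
    simp only [Set.mem_union, Set.mem_ofPred_eq, ha, true_and, not_or, not_not] at hn
    exact ha' (by simp [hn.1, hn.2])
  | smul r f _ hf =>
    intro y
    refine (hf y).subset ?_
    rintro a ⟨ha, ha'⟩
    exact ⟨ha, fun h => ha' (by simp [h])⟩

theorem conv_add_left {f f' : Arr 𝒢 → R} (hf : FinTgt f) (hf' : FinTgt f') (ξ : Arr 𝒢 → R) :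
    conv (f + f') ξ = conv f ξ + conv f' ξ := by
  funext g
  simp only [conv, Pi.add_apply, add_mul]
  exact finsum_add_distrib (hf.finite_support ξ g) (hf'.finite_support ξ g)

theorem conv_add_right {f : Arr 𝒢 → R} (hf : FinTgt f) (ξ ξ' : Arr 𝒢 → R) :
    conv f (ξ + ξ') = conv f ξ + conv f ξ' := by
  funext g
  simp only [conv, Pi.add_apply, mul_add]
  exact finsum_add_distrib (hf.finite_support ξ g) (hf.finite_support ξ' g)

theorem conv_smul_left {f : Arr 𝒢 → R} (hf : FinTgt f) (r : R) (ξ : Arr 𝒢 → R) :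
    conv (r • f) ξ = r • conv f ξ := by
  funext g
  simp only [conv, Pi.smul_apply, smul_eq_mul, mul_assoc]
  exact (mul_finsum' _ r (hf.finite_support ξ g)).symm

theorem conv_smul_right {f : Arr 𝒢 → R} (hf : FinTgt f) (r : R) (ξ : Arr 𝒢 → R) :
    conv f (r • ξ) = r • conv f ξ := by
  funext g
  simp only [conv, Pi.smul_apply, smul_eq_mul, mul_left_comm _ r]
  exact (mul_finsum' _ r (hf.finite_support ξ g)).symm

theorem conv_zero_left (ξ : Arr 𝒢 → R) : conv 0 ξ = 0 := by
  funext g; simp [conv]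

theorem conv_zero_right (f : Arr 𝒢 → R) : conv f 0 = 0 := by
  funext g; simp [conv]

/-- The product of two sets of arrows. -/
def mulSet (U V : Set (Arr 𝒢)) : Set (Arr 𝒢) :=
  {k | ∃ g ∈ U, ∃ h ∈ V, ∃ e : g.src = h.tgt, k = Arr.mul g h e}

theorem mem_mulSet_iff {U V : Set (Arr 𝒢)} (hU : Set.InjOn Arr.tgt U) {x y z : 𝒢} (a : x ⟶ y)
    (k : z ⟶ y) (hk : (⟨z, y, k⟩ : Arr 𝒢) ∈ U) :
    (⟨x, y, a⟩ : Arr 𝒢) ∈ mulSet U V ↔ (⟨x, z, a ≫ inv k⟩ : Arr 𝒢) ∈ V := by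
  constructor
  · rintro ⟨⟨z', y', g⟩, hg, ⟨x', w, h⟩, hh, e, he⟩
    dsimp only at e
    subst e
    simp only [Arr.mul, eqToHom_refl, Category.id_comp, Arr.mk.injEq] at he
    obtain ⟨rfl, rfl, he⟩ := he
    have he := eq_of_heq he
    have := hU hg hk rfl
    cases this
    simpa [he] using hh
  · intro h
    exact ⟨_, hk, _, h, rfl, by simp [Arr.mul]⟩

theorem conv_charFn_charFn {U V : Set (Arr 𝒢)} (hU : Set.InjOn Arr.tgt U) :
    conv (charFn R U) (charFn R V) = charFn R (mulSet U V) := by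
  funext ⟨x, y, a⟩
  by_cases hn : ∃ (z : 𝒢) (k : z ⟶ y), (⟨z, y, k⟩ : Arr 𝒢) ∈ U
  · obtain ⟨z, k, hk⟩ := hn
    rw [conv_charFn_of_mem hU _ a k hk]
    by_cases h : (⟨x, z, a ≫ inv k⟩ : Arr 𝒢) ∈ V
    · simp [charFn, h, (mem_mulSet_iff hU a k hk).2 h]
    · simp [charFn, h, mt (mem_mulSet_iff hU a k hk).1 h]
  · rw [conv_charFn_of_notMem _ a hn]
    have : (⟨x, y, a⟩ : Arr 𝒢) ∉ mulSet U V := by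
      rintro ⟨⟨z', y', g⟩, hg, ⟨x', w, h⟩, hh, e, he⟩
      simp only [Arr.mul, Arr.mk.injEq] at he
      obtain ⟨_, rfl, _⟩ := he
      exact hn ⟨_, _, hg⟩
    simp [charFn, this]

theorem conv_charFn_conv_charFn {U V : Set (Arr 𝒢)} (hU : Set.InjOn Arr.tgt U)
    (hV : Set.InjOn Arr.tgt V) (hUV : Set.InjOn Arr.tgt (mulSet U V)) (ξ : Arr 𝒢 → R) :
    conv (conv (charFn R U) (charFn R V)) ξ = conv (charFn R U) (conv (charFn R V) ξ) := by
  rw [conv_charFn_charFn hU]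
  funext ⟨x, y, a⟩
  by_cases hn : ∃ (z : 𝒢) (k : z ⟶ y), (⟨z, y, k⟩ : Arr 𝒢) ∈ U
  · obtain ⟨z, k, hk⟩ := hn
    rw [conv_charFn_of_mem hU _ a k hk]
    by_cases hm : ∃ (w : 𝒢) (l : w ⟶ z), (⟨w, z, l⟩ : Arr 𝒢) ∈ V
    · obtain ⟨w, l, hl⟩ := hm
      rw [conv_charFn_of_mem hV _ _ l hl, conv_charFn_of_mem hUV _ a (l ≫ k)]
      · simp
      · rw [mem_mulSet_iff hU _ k hk]
        simpa using hl
    · rw [conv_charFn_of_notMem _ _ hm, conv_charFn_of_notMem _ _]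
      rintro ⟨w, l, hl⟩
      rw [mem_mulSet_iff hU _ k hk] at hl
      exact hm ⟨_, _, hl⟩
  · rw [conv_charFn_of_notMem _ a hn, conv_charFn_of_notMem _ _]
    rintro ⟨w, l, ⟨z', y', g⟩, hg, ⟨x', w, h⟩, hh, e, he⟩
    simp only [Arr.mul, Arr.mk.injEq] at he
    obtain ⟨_, rfl, _⟩ := he
    exact hn ⟨_, _, hg⟩

end Helper

section Inverses

variable {𝒢 : Type u} [Groupoid.{v} 𝒢]

theorem Arr.mul_inv_mul {k h : Arr 𝒢} (e : k.src = h.src) :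
    Arr.mul (Arr.mul k (Arr.inv h) e) h rfl = k := by
  obtain ⟨x, y, k⟩ := k
  obtain ⟨x', z, h⟩ := h
  dsimp only at e
  subst e
  simp only [Arr.mul, Arr.inv, eqToHom_refl, Category.id_comp, Arr.mk.injEq, heq_eq_eq, true_and]
  exact (congrArg (h ≫ ·) (Category.id_comp _)).trans (IsIso.hom_inv_id_assoc h k)

theorem Arr.mul_mul_inv {g h : Arr 𝒢} (e : g.src = h.tgt) :
    Arr.mul (Arr.mul g h e) (Arr.inv h) rfl = g := by
  obtain ⟨x, y, g⟩ := g
  obtain ⟨x', z, h⟩ := h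
  dsimp only at e
  subst e
  simp [Arr.mul, Arr.inv]

theorem Arr.inv_inv (g : Arr 𝒢) : Arr.inv (Arr.inv g) = g := by
  obtain ⟨x, y, g⟩ := g
  simp [Arr.inv]

end Inverses

section Bisections

variable {𝒢 : Type u} [Groupoid.{v} 𝒢] [TopologicalSpace 𝒢] [TopologicalSpace (Arr 𝒢)]

theorem IsCompactOpenBisection.injOn_tgt_mulSet {U V : Set (Arr 𝒢)}
    (hU : IsCompactOpenBisection U) (hV : IsCompactOpenBisection V) :
    Set.InjOn Arr.tgt (mulSet U V) := by
  rintro _ ⟨g, hg, h, hh, e, rfl⟩ _ ⟨g', hg', h', hh', e', rfl⟩ he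
  have h1 : g = g' := hU.injOn_tgt hg hg' he
  subst h1
  have h2 : h = h' := hV.injOn_tgt hh hh' (e.symm.trans e')
  subst h2
  rfl

theorem IsCompactOpenBisection.injOn_src_mulSet {U V : Set (Arr 𝒢)}
    (hU : IsCompactOpenBisection U) (hV : IsCompactOpenBisection V) :
    Set.InjOn Arr.src (mulSet U V) := by
  rintro _ ⟨g, hg, h, hh, e, rfl⟩ _ ⟨g', hg', h', hh', e', rfl⟩ he
  have h1 : h = h' := hV.injOn_src hh hh' he
  subst h1
  have h2 : g = g' := hU.injOn_src hg hg' (e.trans e'.symm)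
  subst h2
  rfl

theorem IsCompactOpenBisection.mul [HausdorffAmpleGroupoid 𝒢] {U V : Set (Arr 𝒢)}
    (hU : IsCompactOpenBisection U) (hV : IsCompactOpenBisection V) :
    IsCompactOpenBisection (mulSet U V) where
  injOn_src := hU.injOn_src_mulSet hV
  injOn_tgt := hU.injOn_tgt_mulSet hV
  isCompact := by
    have : T2Space (Arr 𝒢) := HausdorffAmpleGroupoid.t2Space_arr
    have : T2Space 𝒢 := (TopologicalGroupoid.isEmbedding_unit (𝒢 := 𝒢)).t2Space
    have hc : IsClosed {q : Arr 𝒢 × Arr 𝒢 | q.1.src = q.2.tgt} :=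
      isClosed_eq (TopologicalGroupoid.continuous_src.comp continuous_fst)
        (TopologicalGroupoid.continuous_tgt.comp continuous_snd)
    have hK : IsCompact ((Subtype.val : {q : Arr 𝒢 × Arr 𝒢 // q.1.src = q.2.tgt} → _) ⁻¹'
        (U ×ˢ V)) :=
      hc.isClosedEmbedding_subtypeVal.isCompact_preimage (hU.isCompact.prod hV.isCompact)
    convert hK.image TopologicalGroupoid.continuous_mul using 1
    ext k
    constructor
    · rintro ⟨g, hg, h, hh, e, rfl⟩
      exact ⟨⟨(g, h), e⟩, ⟨hg, hh⟩, rfl⟩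
    · rintro ⟨⟨⟨g, h⟩, e⟩, ⟨hg, hh⟩, rfl⟩
      exact ⟨g, hg, h, hh, e, rfl⟩
  isOpen := by
    have hs : IsLocalHomeomorph (Arr.src : Arr 𝒢 → 𝒢) := EtaleGroupoid.isLocalHomeomorph_src
    have hemb : IsOpenEmbedding (V.domRestrict (Arr.src : Arr 𝒢 → 𝒢)) :=
      .of_continuous_injective_isOpenMap (hs.continuous.comp continuous_subtype_val)
        hV.injOn_src.injective (hs.isOpenMap.comp hV.isOpen.isOpenMap_subtype_val)
    let σ := hemb.isEmbedding.toHomeomorph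
    let W : Set (Arr 𝒢) := Arr.src ⁻¹' Set.range (V.domRestrict (Arr.src : Arr 𝒢 → 𝒢))
    have hW : IsOpen W := hemb.isOpen_range.preimage hs.continuous
    let τ : W → V := fun k => σ.symm ⟨k.1.src, k.2⟩
    have hτ : Continuous τ :=
      σ.symm.continuous.comp ((hs.continuous.comp continuous_subtype_val).subtype_mk _)
    have hτs : ∀ k : W, k.1.src = (τ k).1.src := fun k =>
      (congrArg Subtype.val (σ.apply_symm_apply ⟨k.1.src, k.2⟩)).symm
    let θ : W → Arr 𝒢 := fun k => Arr.mul k.1 (Arr.inv (τ k).1) (hτs k)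
    have hθ : Continuous θ := by
      have h1 : Continuous (fun k : W => (k.1, Arr.inv (τ k).1)) :=
        continuous_subtype_val.prodMk
          (TopologicalGroupoid.continuous_inv.comp (continuous_subtype_val.comp hτ))
      exact TopologicalGroupoid.continuous_mul.comp (h1.subtype_mk hτs)
    have hopen := hW.isOpenMap_subtype_val _ (hU.isOpen.preimage hθ)
    convert hopen using 1
    ext k
    constructor
    · rintro ⟨g, hg, h, hh, e, rfl⟩
      have hw : Arr.mul g h e ∈ W := ⟨⟨h, hh⟩, rfl⟩
      refine ⟨⟨_, hw⟩, ?_, rfl⟩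
      have h1 : (τ ⟨_, hw⟩).1 = h := hV.injOn_src (τ ⟨_, hw⟩).2 hh (hτs ⟨_, hw⟩).symm
      have h2 : θ ⟨_, hw⟩ = g := by
        simp only [θ, h1]
        exact Arr.mul_mul_inv e
      change θ ⟨_, hw⟩ ∈ U
      rwa [h2]
    · rintro ⟨k, hk, rfl⟩
      exact ⟨θ k, hk, (τ k).1, (τ k).2, rfl, (Arr.mul_inv_mul (hτs k)).symm⟩

theorem IsCompactOpenBisection.inv [HausdorffAmpleGroupoid 𝒢] {U : Set (Arr 𝒢)}
    (hU : IsCompactOpenBisection U) : IsCompactOpenBisection (Arr.inv ⁻¹' U) where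
  isOpen := hU.isOpen.preimage TopologicalGroupoid.continuous_inv
  isCompact := by
    convert hU.isCompact.image (TopologicalGroupoid.continuous_inv (𝒢 := 𝒢)) using 1
    ext k
    exact ⟨fun h => ⟨_, h, k.inv_inv⟩, by rintro ⟨g, hg, rfl⟩; simpa [Arr.inv_inv] using hg⟩
  injOn_src := by
    intro a ha b hb e
    have := hU.injOn_tgt ha hb e
    rw [← a.inv_inv, this, b.inv_inv]
  injOn_tgt := by
    intro a ha b hb e
    have := hU.injOn_src ha hb e
    rw [← a.inv_inv, this, b.inv_inv]

end Bisections

/-! ### The Steinberg algebra -/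

section Steinberg

variable {R : Type w} [CommRing R] {𝒢 : Type u} [Groupoid.{v} 𝒢] [TopologicalSpace 𝒢]
  [TopologicalSpace (Arr 𝒢)] [HausdorffAmpleGroupoid 𝒢]

theorem conv_mem {f g : Arr 𝒢 → R} (hf : f ∈ steinbergSpan R 𝒢) (hg : g ∈ steinbergSpan R 𝒢) :
    conv f g ∈ steinbergSpan R 𝒢 := by
  induction hf using Submodule.span_induction with
  | mem f hf =>
    obtain ⟨U, hU, rfl⟩ := hf
    have hfin : FinTgt (charFn R U) := .of_mem (Submodule.subset_span ⟨U, hU, rfl⟩)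
    induction hg using Submodule.span_induction with
    | mem g hg =>
      obtain ⟨V, hV, rfl⟩ := hg
      rw [conv_charFn_charFn hU.injOn_tgt]
      exact Submodule.subset_span ⟨_, hU.mul hV, rfl⟩
    | zero => rw [conv_zero_right]; exact zero_mem _
    | add _ _ _ _ h1 h2 => rw [conv_add_right hfin]; exact add_mem h1 h2
    | smul r _ _ h => rw [conv_smul_right hfin]; exact Submodule.smul_mem _ r h
  | zero => rw [conv_zero_left]; exact zero_mem _
  | add _ _ hx hy h1 h2 => rw [conv_add_left (.of_mem hx) (.of_mem hy)]; exact add_mem h1 h2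
  | smul r _ hx h => rw [conv_smul_left (.of_mem hx)]; exact Submodule.smul_mem _ r h

theorem conv_conv {f g : Arr 𝒢 → R} (hf : f ∈ steinbergSpan R 𝒢) (hg : g ∈ steinbergSpan R 𝒢)
    (ξ : Arr 𝒢 → R) : conv (conv f g) ξ = conv f (conv g ξ) := by
  induction hf using Submodule.span_induction with
  | mem f hf =>
    obtain ⟨U, hU, rfl⟩ := hf
    have hmU : charFn R U ∈ steinbergSpan R 𝒢 := Submodule.subset_span ⟨U, hU, rfl⟩
    have hfin : FinTgt (charFn R U) := .of_mem hmU
    induction hg using Submodule.span_induction with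
    | mem g hg =>
      obtain ⟨V, hV, rfl⟩ := hg
      exact conv_charFn_conv_charFn hU.injOn_tgt hV.injOn_tgt (hU.injOn_tgt_mulSet hV) ξ
    | zero => simp only [conv_zero_right, conv_zero_left]
    | add _ _ hx hy h1 h2 =>
      rw [conv_add_right hfin, conv_add_left (.of_mem (conv_mem hmU hx))
        (.of_mem (conv_mem hmU hy)), conv_add_left (.of_mem hx) (.of_mem hy),
        conv_add_right hfin, h1, h2]
    | smul r _ hx h =>
      rw [conv_smul_right hfin, conv_smul_left (.of_mem (conv_mem hmU hx)),
        conv_smul_left (.of_mem hx), conv_smul_right hfin, h]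
  | zero => simp only [conv_zero_left]
  | add _ _ hx hy h1 h2 =>
    rw [conv_add_left (.of_mem hx) (.of_mem hy), conv_add_left (.of_mem (conv_mem hx hg))
      (.of_mem (conv_mem hy hg)), conv_add_left (.of_mem hx) (.of_mem hy), h1, h2]
  | smul r _ hx h =>
    rw [conv_smul_left (.of_mem hx), conv_smul_left (.of_mem (conv_mem hx hg)),
      conv_smul_left (.of_mem hx), h]

end Steinberg

/-- The Steinberg algebra `R𝒢`: the `R`-algebra spanned by the characteristic functions of compact
open bisections, with the convolution product. -/
def SteinbergAlgebra (R : Type w) [CommRing R] (𝒢 : Type u) [Groupoid.{v} 𝒢]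
    [TopologicalSpace (Arr 𝒢)] : Type (max u v w) :=
  ↥(steinbergSpan R 𝒢)

namespace SteinbergAlgebra

variable (R : Type w) [CommRing R] (𝒢 : Type u) [Groupoid.{v} 𝒢] [TopologicalSpace (Arr 𝒢)]

instance : AddCommGroup (SteinbergAlgebra R 𝒢) :=
  inferInstanceAs (AddCommGroup ↥(steinbergSpan R 𝒢))

instance : Module R (SteinbergAlgebra R 𝒢) :=
  inferInstanceAs (Module R ↥(steinbergSpan R 𝒢))

variable [TopologicalSpace 𝒢] [HausdorffAmpleGroupoid 𝒢]

noncomputable instance : Mul (SteinbergAlgebra R 𝒢) :=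
  ⟨fun f g => ⟨conv f.1 g.1, conv_mem f.2 g.2⟩⟩

noncomputable instance : NonUnitalRing (SteinbergAlgebra R 𝒢) where
  left_distrib f g h := Subtype.ext (conv_add_right (.of_mem f.2) g.1 h.1)
  right_distrib f g h := Subtype.ext (conv_add_left (.of_mem f.2) (.of_mem g.2) h.1)
  zero_mul f := Subtype.ext (conv_zero_left f.1)
  mul_zero f := Subtype.ext (conv_zero_right f.1)
  mul_assoc f g h := Subtype.ext (conv_conv f.2 g.2 h.1)

instance : IsScalarTower R (SteinbergAlgebra R 𝒢) (SteinbergAlgebra R 𝒢) :=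
  ⟨fun r f g => Subtype.ext (conv_smul_left (.of_mem f.2) r g.1)⟩

instance : SMulCommClass R (SteinbergAlgebra R 𝒢) (SteinbergAlgebra R 𝒢) :=
  ⟨fun r f g => Subtype.ext (conv_smul_right (.of_mem f.2) r g.1).symm⟩

end SteinbergAlgebra

/-! ### Operators on `c₀(X, ℤ_p)` -/

section Operators

variable (p : ℕ) [Fact p.Prime] (X : Type u)

/-- The submodule of functions on the (discrete) set `X` that vanish at infinity. -/
def c0Submodule : Submodule ℤ_[p] (X → ℤ_[p]) where
  carrier := {ξ | Tendsto ξ cofinite (𝓝 0)}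
  zero_mem' := tendsto_const_nhds
  add_mem' {a b} h1 h2 := by
    have := Tendsto.add h1 h2
    rwa [add_zero] at this
  smul_mem' r _ h := by
    have := Tendsto.const_smul h r
    rwa [smul_zero] at this

/-- The `ℤ_p`-module `c₀(X, ℤ_p)`. -/
def C0 : Type u := ↥(c0Submodule p X)

noncomputable instance : AddCommGroup (C0 p X) := inferInstanceAs (AddCommGroup ↥(c0Submodule p X))

noncomputable instance : Module ℤ_[p] (C0 p X) := inferInstanceAs (Module ℤ_[p] ↥(c0Submodule p X))

variable {p X}

/-- The supremum norm on `c₀(X, ℤ_p)`. -/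
noncomputable def c0Norm (ξ : C0 p X) : ℝ := ⨆ x, ‖ξ.1 x‖

/-- The canonical pairing `⟨ξ, η⟩ = ∑ₓ ξ(x) η(x)`. -/
noncomputable def pairing (ξ η : C0 p X) : ℤ_[p] := ∑' x, ξ.1 x * η.1 x

/-- The operator norm `‖T‖ = sup_{‖ξ‖ ≤ 1} ‖T ξ‖`. -/
noncomputable def opNorm (T : Module.End ℤ_[p] (C0 p X)) : ℝ :=
  ⨆ ξ : {ξ : C0 p X // c0Norm ξ ≤ 1}, c0Norm (T ξ.1)

theorem c0Norm_le_iff (ξ : C0 p X) {ε : ℝ} (hε : 0 ≤ ε) : c0Norm ξ ≤ ε ↔ ∀ x, ‖ξ.1 x‖ ≤ ε := by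
  constructor
  · intro h x
    exact (le_ciSup (f := fun x => ‖ξ.1 x‖) ⟨1, by rintro _ ⟨x, rfl⟩; exact PadicInt.norm_le_one _⟩
      x).trans h
  · intro h
    exact Real.iSup_le h hε

theorem c0Norm_le_one (ξ : C0 p X) : c0Norm ξ ≤ 1 :=
  (c0Norm_le_iff ξ zero_le_one).2 fun _ => PadicInt.norm_le_one _

/-- Since all vectors have norm at most one, every operator is bounded, and its norm is the
supremum of all the matrix coefficients that it produces. -/
theorem opNorm_le_iff (T : Module.End ℤ_[p] (C0 p X)) {ε : ℝ} (hε : 0 ≤ ε) :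
    opNorm T ≤ ε ↔ ∀ ξ x, ‖(T ξ).1 x‖ ≤ ε := by
  constructor
  · intro h ξ
    rw [← c0Norm_le_iff _ hε]
    exact (le_ciSup (f := fun ξ : {ξ : C0 p X // c0Norm ξ ≤ 1} => c0Norm (T ξ.1))
      ⟨1, by rintro _ ⟨x, rfl⟩; exact c0Norm_le_one _⟩ ⟨ξ, c0Norm_le_one ξ⟩).trans h
  · intro h
    exact Real.iSup_le (fun ξ => (c0Norm_le_iff _ hε).2 (h ξ.1)) hε

theorem summable_pairing (ξ η : C0 p X) : Summable fun x => ξ.1 x * η.1 x := by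
  apply NonarchimedeanAddGroup.summable_of_tendsto_cofinite_zero
  have h1 : Tendsto ξ.1 cofinite (𝓝 0) := ξ.2
  have h2 : Tendsto η.1 cofinite (𝓝 0) := η.2
  simpa using h1.mul h2

theorem pairing_add_right (ξ η η' : C0 p X) :
    pairing ξ (η + η') = pairing ξ η + pairing ξ η' := by
  unfold pairing
  rw [← (summable_pairing ξ η).tsum_add (summable_pairing ξ η')]
  exact tsum_congr fun x => mul_add _ _ _

theorem pairing_add_left (ξ ξ' η : C0 p X) :
    pairing (ξ + ξ') η = pairing ξ η + pairing ξ' η := by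
  unfold pairing
  rw [← (summable_pairing ξ η).tsum_add (summable_pairing ξ' η)]
  exact tsum_congr fun x => add_mul _ _ _

theorem pairing_smul_right (r : ℤ_[p]) (ξ η : C0 p X) : pairing ξ (r • η) = r * pairing ξ η := by
  unfold pairing
  rw [← (summable_pairing ξ η).tsum_mul_left]
  exact tsum_congr fun x => mul_left_comm _ _ _

theorem pairing_smul_left (r : ℤ_[p]) (ξ η : C0 p X) : pairing (r • ξ) η = r * pairing ξ η := by
  unfold pairing
  rw [← (summable_pairing ξ η).tsum_mul_left]
  exact tsum_congr fun x => mul_assoc _ _ _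

variable (p X)

/-- The algebra `𝓑(c₀(X, ℤ_p))` of (bounded) `ℤ_p`-linear operators that are adjointable with respect
to the canonical pairing. -/
noncomputable def adjointable : Subalgebra ℤ_[p] (Module.End ℤ_[p] (C0 p X)) where
  carrier := {T | ∃ S : Module.End ℤ_[p] (C0 p X), ∀ ξ η, pairing ξ (T η) = pairing (S ξ) η}
  mul_mem' := by
    rintro T T' ⟨S, hS⟩ ⟨S', hS'⟩
    exact ⟨S' * S, fun ξ η => by simp [Module.End.mul_apply, hS, hS']⟩
  add_mem' := by
    rintro T T' ⟨S, hS⟩ ⟨S', hS'⟩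
    exact ⟨S + S', fun ξ η => by
      simp only [LinearMap.add_apply, pairing_add_right, pairing_add_left, hS, hS']⟩
  algebraMap_mem' r := ⟨algebraMap _ _ r, fun ξ η => by
    simp only [Module.algebraMap_end_apply, pairing_smul_right, pairing_smul_left]⟩

end Operators

/-! ### The `p`-adic operator algebra of an ample groupoid -/

theorem norm_conv_le {p : ℕ} [Fact p.Prime] {𝒢 : Type u} [Groupoid.{v} 𝒢]
    (f ξ : Arr 𝒢 → ℤ_[p]) {ε : ℝ} (hε : 0 ≤ ε) (h : ∀ x, ‖ξ x‖ ≤ ε) (g : Arr 𝒢) :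
    ‖conv f ξ g‖ ≤ ε := by
  unfold conv
  refine finsum_induction (fun a => ‖a‖ ≤ ε) (by simpa using hε)
    (fun a b ha hb => (PadicInt.nonarchimedean a b).trans (max_le ha hb)) fun k => ?_
  rw [norm_mul]
  exact (mul_le_of_le_one_left (norm_nonneg _) (PadicInt.norm_le_one _)).trans (h _)

section PadicAlgebra

variable {p : ℕ} [Fact p.Prime] {𝒢 : Type u} [Groupoid.{v} 𝒢] [TopologicalSpace 𝒢]
  [TopologicalSpace (Arr 𝒢)] [HausdorffAmpleGroupoid 𝒢]

theorem conv_mem_c0 {f : Arr 𝒢 → ℤ_[p]} (hf : f ∈ steinbergSpan ℤ_[p] 𝒢) (ξ : C0 p (Arr 𝒢)) :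
    conv f ξ.1 ∈ c0Submodule p (Arr 𝒢) := by
  induction hf using Submodule.span_induction with
  | mem f hf =>
    obtain ⟨U, hU, rfl⟩ := hf
    intro W hW
    have hF : {h | ξ.1 h ∉ W}.Finite := ξ.2 hW
    rw [mem_map, mem_cofinite]
    refine (hF.biUnion (t := fun h => {k | ∃ g ∈ U, ∃ e : g.src = h.tgt, k = Arr.mul g h e})
      fun h _ => Set.Subsingleton.finite ?_).subset ?_
    · rintro _ ⟨g, hg, e, rfl⟩ _ ⟨g', hg', e', rfl⟩
      obtain rfl := hU.injOn_src hg hg' (e.trans e'.symm)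
      rfl
    · rintro ⟨x, y, a⟩ ha
      simp only [Set.mem_compl_iff, Set.mem_preimage] at ha
      by_cases hn : ∃ (z : 𝒢) (k : z ⟶ y), (⟨z, y, k⟩ : Arr 𝒢) ∈ U
      · obtain ⟨z, k, hk⟩ := hn
        rw [conv_charFn_of_mem hU.injOn_tgt _ a k hk] at ha
        simp only [Set.mem_iUnion]
        exact ⟨_, ha, _, hk, rfl, by simp [Arr.mul]⟩
      · rw [conv_charFn_of_notMem _ a hn] at ha
        exact absurd (mem_of_mem_nhds hW) ha
  | zero => rw [conv_zero_left]; exact zero_mem _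
  | add _ _ hx hy h1 h2 => rw [conv_add_left (.of_mem hx) (.of_mem hy)]; exact add_mem h1 h2
  | smul r _ hx h => rw [conv_smul_left (.of_mem hx)]; exact Submodule.smul_mem _ r h

/-- The left convolution operator `ξ ↦ f * ξ` on `c₀(𝒢, ℤ_p)`, for `f` in the Steinberg algebra. -/
noncomputable def leftConv (f : SteinbergAlgebra ℤ_[p] 𝒢) : Module.End ℤ_[p] (C0 p (Arr 𝒢)) where
  toFun ξ := ⟨conv f.1 ξ.1, conv_mem_c0 f.2 ξ⟩
  map_add' ξ η := Subtype.ext (conv_add_right (.of_mem f.2) ξ.1 η.1)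
  map_smul' r ξ := Subtype.ext (conv_smul_right (.of_mem f.2) r ξ.1)

theorem leftConv_add (f g : SteinbergAlgebra ℤ_[p] 𝒢) :
    leftConv (f + g) = leftConv f + leftConv g :=
  LinearMap.ext fun ξ => Subtype.ext (conv_add_left (.of_mem f.2) (.of_mem g.2) ξ.1)

theorem leftConv_smul (r : ℤ_[p]) (f : SteinbergAlgebra ℤ_[p] 𝒢) :
    leftConv (r • f) = r • leftConv f :=
  LinearMap.ext fun ξ => Subtype.ext (conv_smul_left (.of_mem f.2) r ξ.1)

theorem leftConv_zero : leftConv (0 : SteinbergAlgebra ℤ_[p] 𝒢) = 0 :=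
  LinearMap.ext fun ξ => Subtype.ext (conv_zero_left ξ.1)

theorem leftConv_mul (f g : SteinbergAlgebra ℤ_[p] 𝒢) :
    leftConv (f * g) = leftConv f * leftConv g :=
  LinearMap.ext fun ξ => Subtype.ext (conv_conv f.2 g.2 ξ.1)

theorem pairing_conv_charFn {U : Set (Arr 𝒢)} (hU : IsCompactOpenBisection U)
    (ξ η : Arr 𝒢 → ℤ_[p]) :
    ∑' a, ξ a * conv (charFn ℤ_[p] U) η a = ∑' h, conv (charFn ℤ_[p] (Arr.inv ⁻¹' U)) ξ h * η h := by
  have key : ∀ h : Arr 𝒢, conv (charFn ℤ_[p] (Arr.inv ⁻¹' U)) ξ h * η h ≠ 0 →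
      ∃ m : Arr 𝒢, ∃ k ∈ U, ∃ e : k.src = h.tgt, m = Arr.mul k h e := by
    rintro ⟨x, y, a⟩ hne
    by_contra hn
    apply hne
    rw [conv_charFn_of_notMem, zero_mul]
    rintro ⟨z, k, hk⟩
    exact hn ⟨_, _, hk, rfl, rfl⟩
  choose m hm using key
  refine tsum_eq_tsum_of_ne_zero_bij (fun h => m h.1 h.2) ?_ ?_ ?_
  · rintro ⟨h, hh⟩ ⟨h', hh'⟩ e
    dsimp only at e
    obtain ⟨k, hk, e1, hm1⟩ := hm h hh
    obtain ⟨k', hk', e2, hm2⟩ := hm h' hh'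
    rw [hm1, hm2] at e
    obtain rfl : k = k' := hU.injOn_tgt hk hk' (by simpa [Arr.mul] using congrArg Arr.tgt e)
    apply Subtype.ext
    clear hm1 hm2
    dsimp only
    obtain ⟨x, y, a⟩ := h
    obtain ⟨x', y', a'⟩ := h'
    dsimp only at e1 e2
    subst e1
    subst e2
    simp only [Arr.mul, Arr.mk.injEq, eqToHom_refl, Category.id_comp, true_and] at e
    obtain ⟨rfl, e⟩ := e
    have e := eq_of_heq e
    rw [cancel_mono] at e
    rw [e]
  · rintro ⟨x, y, a⟩ ha
    rw [Function.mem_support] at ha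
    by_cases hn : ∃ (z : 𝒢) (k : z ⟶ y), (⟨z, y, k⟩ : Arr 𝒢) ∈ U
    · obtain ⟨z, l, hl⟩ := hn
      rw [conv_charFn_of_mem hU.injOn_tgt _ a l hl] at ha
      have hl' : (⟨y, z, inv l⟩ : Arr 𝒢) ∈ Arr.inv ⁻¹' U := by
        simpa [Arr.inv] using hl
      have h1 : conv (charFn ℤ_[p] (Arr.inv ⁻¹' U)) ξ ⟨x, z, a ≫ inv l⟩ = ξ ⟨x, y, a⟩ := by
        rw [conv_charFn_of_mem hU.inv.injOn_tgt _ _ _ hl']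
        simp
      have h2 : conv (charFn ℤ_[p] (Arr.inv ⁻¹' U)) ξ ⟨x, z, a ≫ inv l⟩ *
          η ⟨x, z, a ≫ inv l⟩ ≠ 0 := by rwa [h1]
      refine ⟨⟨_, h2⟩, ?_⟩
      obtain ⟨k, hk, e, hm1⟩ := hm _ h2
      obtain rfl : k = ⟨z, y, l⟩ := hU.injOn_src hk hl e
      dsimp only
      rw [hm1]
      simp [Arr.mul]
    · rw [conv_charFn_of_notMem _ a hn, mul_zero] at ha
      exact absurd rfl ha
  · rintro ⟨⟨x, y, h⟩, hh⟩
    obtain ⟨⟨z, w, l⟩, hk, e, hm1⟩ := hm _ hh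
    dsimp only at e ⊢
    rw [hm1]
    clear hm1 hh
    subst e
    have h3 : (⟨w, z, inv l⟩ : Arr 𝒢) ∈ Arr.inv ⁻¹' U := by simpa [Arr.inv] using hk
    rw [conv_charFn_of_mem hU.inv.injOn_tgt _ _ _ h3]
    simp only [Arr.mul, eqToHom_refl, Category.id_comp]
    rw [conv_charFn_of_mem hU.injOn_tgt _ _ _ hk]
    simp

theorem leftConv_mem_adjointable (f : SteinbergAlgebra ℤ_[p] 𝒢) :
    leftConv f ∈ adjointable p (Arr 𝒢) := by
  obtain ⟨f, hf⟩ := f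
  induction hf using Submodule.span_induction with
  | mem f hf =>
    obtain ⟨U, hU, rfl⟩ := hf
    exact ⟨leftConv ⟨charFn ℤ_[p] (Arr.inv ⁻¹' U), Submodule.subset_span ⟨_, hU.inv, rfl⟩⟩,
      fun ξ η => pairing_conv_charFn hU ξ.1 η.1⟩
  | zero =>
    have := (adjointable p (Arr 𝒢)).zero_mem
    rwa [← leftConv_zero] at this
  | add f g hf hg h1 h2 =>
    have := add_mem h1 h2
    exact (leftConv_add (⟨f, hf⟩ : SteinbergAlgebra ℤ_[p] 𝒢) ⟨g, hg⟩) ▸ this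
  | smul r f hf h =>
    have := (adjointable p (Arr 𝒢)).smul_mem h r
    exact (leftConv_smul r (⟨f, hf⟩ : SteinbergAlgebra ℤ_[p] 𝒢)) ▸ this

variable (p 𝒢)

/-- The left regular representation `λ : ℤ_p 𝒢 → 𝓑(c₀(𝒢, ℤ_p))`, `λ(f) ξ = f * ξ`. -/
noncomputable def regularRep : SteinbergAlgebra ℤ_[p] 𝒢 →ₙₐ[ℤ_[p]] adjointable p (Arr 𝒢) where
  toFun f := ⟨leftConv f, leftConv_mem_adjointable f⟩
  map_smul' r f := Subtype.ext (leftConv_smul r f)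
  map_zero' := Subtype.ext leftConv_zero
  map_add' f g := Subtype.ext (leftConv_add f g)
  map_mul' f g := Subtype.ext (leftConv_mul f g)

theorem exists_opNorm_sub_le_iff (T : adjointable p (Arr 𝒢)) :
    (∀ ε > 0, ∃ f : SteinbergAlgebra ℤ_[p] 𝒢, opNorm (T.1 - (regularRep p 𝒢 f).1) < ε) ↔
      ∀ ε > 0, ∃ f : SteinbergAlgebra ℤ_[p] 𝒢, ∀ ξ x,
        ‖(T.1 ξ).1 x - (leftConv f ξ).1 x‖ ≤ ε := by
  constructor
  · intro h ε hε
    obtain ⟨f, hf⟩ := h ε hε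
    exact ⟨f, (opNorm_le_iff _ hε.le).1 hf.le⟩
  · intro h ε hε
    obtain ⟨f, hf⟩ := h (ε / 2) (half_pos hε)
    exact ⟨f, ((opNorm_le_iff _ (half_pos hε).le).2 hf).trans_lt (half_lt_self hε)⟩

/-- The `p`-adic operator algebra `𝓞_p(𝒢)`: the closure, in the operator norm, of the image of
`ℤ_p 𝒢` under the left regular representation. -/
noncomputable def padicGroupoidAlgebra : NonUnitalSubalgebra ℤ_[p] (adjointable p (Arr 𝒢)) where
  carrier := {T | ∀ ε > 0, ∃ f : SteinbergAlgebra ℤ_[p] 𝒢, opNorm (T.1 - (regularRep p 𝒢 f).1) < ε}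
  zero_mem' := by
    rw [Set.mem_ofPred, exists_opNorm_sub_le_iff]
    intro ε hε
    refine ⟨0, fun ξ x => ?_⟩
    rw [leftConv_zero]
    simpa using hε.le
  add_mem' := by
    intro T S hT hS
    rw [Set.mem_ofPred, exists_opNorm_sub_le_iff] at *
    intro ε hε
    obtain ⟨f, hf⟩ := hT ε hε
    obtain ⟨g, hg⟩ := hS ε hε
    refine ⟨f + g, fun ξ x => ?_⟩
    have : ((T + S).1 ξ).1 x - (leftConv (f + g) ξ).1 x =
        ((T.1 ξ).1 x - (leftConv f ξ).1 x) + ((S.1 ξ).1 x - (leftConv g ξ).1 x) := by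
      rw [leftConv_add]
      exact add_sub_add_comm _ _ _ _
    rw [this]
    exact (PadicInt.nonarchimedean _ _).trans (max_le (hf ξ x) (hg ξ x))
  smul_mem' := by
    intro r T hT
    rw [Set.mem_ofPred, exists_opNorm_sub_le_iff] at *
    intro ε hε
    obtain ⟨f, hf⟩ := hT ε hε
    refine ⟨r • f, fun ξ x => ?_⟩
    have : ((r • T).1 ξ).1 x - (leftConv (r • f) ξ).1 x =
        r * ((T.1 ξ).1 x - (leftConv f ξ).1 x) := by
      rw [leftConv_smul]
      exact (mul_sub _ _ _).symm
    rw [this, norm_mul]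
    exact (mul_le_of_le_one_left (norm_nonneg _) (PadicInt.norm_le_one r)).trans (hf ξ x)
  mul_mem' := by
    intro T S hT hS
    rw [Set.mem_ofPred, exists_opNorm_sub_le_iff] at *
    intro ε hε
    obtain ⟨f, hf⟩ := hT ε hε
    obtain ⟨g, hg⟩ := hS ε hε
    refine ⟨f * g, fun ξ x => ?_⟩
    have : ((T * S).1 ξ).1 x - (leftConv (f * g) ξ).1 x =
        ((T.1 (S.1 ξ)).1 x - (leftConv f (S.1 ξ)).1 x) +
          (leftConv f (S.1 ξ - leftConv g ξ)).1 x := by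
      rw [leftConv_mul, map_sub]
      exact (sub_add_sub_cancel _ _ _).symm
    rw [this]
    exact (PadicInt.nonarchimedean _ _).trans
      (max_le (hf _ x) (norm_conv_le f.1 _ hε.le (hg ξ) x))

end PadicAlgebra

/-! ### Reduction modulo `p` and `p`-simplicity -/

section ModP

variable (p : ℕ) (A : Type w) [NonUnitalRing A]

/-- The two-sided ideal `pA = {p a : a ∈ A}` of a ring `A`. -/
def pIdeal : TwoSidedIdeal A :=
  .mk' {a | ∃ b : A, a = p • b} ⟨0, by simp⟩
    (by rintro _ _ ⟨b, rfl⟩ ⟨c, rfl⟩; exact ⟨b + c, by simp⟩)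
    (by rintro _ ⟨b, rfl⟩; exact ⟨-b, by simp⟩)
    (by rintro x _ ⟨b, rfl⟩; exact ⟨x * b, mul_smul_comm p x b⟩)
    (by rintro _ y ⟨b, rfl⟩; exact ⟨b * y, smul_mul_assoc p b y⟩)

/-- The algebraic quotient `A / pA`. -/
abbrev ModP : Type w := (pIdeal p A).ringCon.Quotient

/-- `A / pA` as a vector space over `𝔽_p`. -/
instance : Module (ZMod p) (ModP p A) :=
  AddCommGroup.zmodModule fun x => by
    induction x using Quotient.inductionOn' with
    | h a =>
      change ((p • a : A) : ModP p A) = ((0 : A) : ModP p A)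
      rw [RingCon.eq, ← TwoSidedIdeal.mem_iff, pIdeal, TwoSidedIdeal.mem_mk']
      exact ⟨a, rfl⟩

/-- A (possibly non-unital) ring is simple if its product is not identically zero and it has no
two-sided ideals other than zero and the whole ring. -/
structure IsSimpleNonUnital : Prop where
  isSimpleRing : IsSimpleRing A
  exists_mul_ne_zero : ∃ a b : A, a * b ≠ 0

/-- `A` is `p`-simple if `A / pA` is simple. (Every additive subgroup of `A / pA` is an
`𝔽_p`-subspace, so there is no difference between ring ideals and `𝔽_p`-algebra ideals.) -/
def IsPSimple : Prop := IsSimpleNonUnital (ModP p A)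

end ModP

end GroupoidAlg

set_option linter.unusedSectionVars false

namespace GroupoidAlg

/-! ### Compact open bisections as a basis, and the clopen unit space -/

section Topology

variable {𝒢 : Type u} [Groupoid.{v} 𝒢] [TopologicalSpace 𝒢] [TopologicalSpace (Arr 𝒢)]

/-! An operator `T` has a symbol, `g ↦ (T δ_{s(g)})(g)`, and the symbol of `λ(f)` is `f` itself. In
`ℤ_p` norm less than one means divisible by `p`, so every `T` in `𝓞_p(𝒢)` is congruent modulo `p` to
some `λ(f)`. The symbol of `T` modulo `p` is then `f` modulo `p`, an element of `𝔽_p 𝒢`, and this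
reduction is multiplicative because congruences can be multiplied. It is surjective because a
locally constant function lifts value by value. If the symbol vanishes modulo `p`, then `p` divides
every value of `T`, and `T / p` is again adjointable; it stays in the closure because every
approximant of `T` at distance less than one is itself divisible by `p`. So the kernel is `p 𝓞_p(𝒢)`
(`exists_bijective_modP`).

Hence `p`-simplicity is simplicity of `𝔽_p 𝒢`, which is settled over any field
(`isSimpleNonUnital_steinbergAlgebra_iff`). An invariant open set gives the ideal of functions
supported over it. An open bisection `B` of non-unit isotropy gives `χ_B - χ_{s(B)}` in the kernel
of the action on functions on units. Conversely, a nonzero element of an ideal can be translated to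
be nonzero at a unit. Effectiveness yields a small set of units over which only its unit part
survives, so cutting down leaves a multiple of some `χ_S`. Minimality spreads such `S` over all
units, and compactness then puts every `χ_B` in the ideal. -/

theorem exists_isOpen_isCompact_subset {X : Type*} [TopologicalSpace X] [LocallyCompactSpace X]
    [T2Space X] [TotallyDisconnectedSpace X] {x : X} {O : Set X} (hO : IsOpen O) (hx : x ∈ O) :
    ∃ C : Set X, IsOpen C ∧ IsCompact C ∧ x ∈ C ∧ C ⊆ O := by
  obtain ⟨K, hK, hxK, hKO⟩ := exists_compact_subset hO hx
  obtain ⟨C, hC, hxC, hCK⟩ := loc_compact_Haus_tot_disc_of_zero_dim.exists_subset_of_mem_open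
    hxK isOpen_interior
  exact ⟨C, hC.2, hK.of_isClosed_subset hC.1 (hCK.trans interior_subset), hxC,
    (hCK.trans interior_subset).trans hKO⟩

theorem t2Space_units [HausdorffAmpleGroupoid 𝒢] : T2Space 𝒢 :=
  have : T2Space (Arr 𝒢) := HausdorffAmpleGroupoid.t2Space_arr
  (TopologicalGroupoid.isEmbedding_unit (𝒢 := 𝒢)).t2Space

theorem isLocalHomeomorph_src [EtaleGroupoid 𝒢] :
    IsLocalHomeomorph (Arr.src : Arr 𝒢 → 𝒢) := EtaleGroupoid.isLocalHomeomorph_src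

theorem exists_injOn_src [EtaleGroupoid 𝒢] (g : Arr 𝒢) :
    ∃ N : Set (Arr 𝒢), IsOpen N ∧ g ∈ N ∧ Set.InjOn Arr.src N := by
  obtain ⟨e, hg, he⟩ := isLocalHomeomorph_src (𝒢 := 𝒢) g
  exact ⟨e.source, e.open_source, hg, he ▸ e.injOn⟩

/-- Inversion is continuous and exchanges source and range. -/
theorem exists_injOn_tgt [EtaleGroupoid 𝒢] (g : Arr 𝒢) :
    ∃ N : Set (Arr 𝒢), IsOpen N ∧ g ∈ N ∧ Set.InjOn Arr.tgt N := by
  obtain ⟨N, hN, hg, hi⟩ := exists_injOn_src (Arr.inv g)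
  refine ⟨Arr.inv ⁻¹' N, hN.preimage TopologicalGroupoid.continuous_inv, hg, ?_⟩
  intro a ha b hb e
  have := hi ha hb e
  rw [← a.inv_inv, this, b.inv_inv]

variable [HausdorffAmpleGroupoid 𝒢]

/-- The compact open bisections form a basis of the topology. -/
theorem exists_bisection {O : Set (Arr 𝒢)} (hO : IsOpen O) {g : Arr 𝒢} (hg : g ∈ O) :
    ∃ B : Set (Arr 𝒢), IsCompactOpenBisection B ∧ g ∈ B ∧ B ⊆ O := by
  have := t2Space_units (𝒢 := 𝒢)
  have : LocallyCompactSpace 𝒢 := HausdorffAmpleGroupoid.locallyCompactSpace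
  have : TotallyDisconnectedSpace 𝒢 := HausdorffAmpleGroupoid.totallyDisconnectedSpace
  obtain ⟨N₁, hN₁, hg₁, hi₁⟩ := exists_injOn_src g
  obtain ⟨N₂, hN₂, hg₂, hi₂⟩ := exists_injOn_tgt g
  set N := O ∩ (N₁ ∩ N₂)
  have hN : IsOpen N := hO.inter (hN₁.inter hN₂)
  have hs := isLocalHomeomorph_src (𝒢 := 𝒢)
  have hiN : Set.InjOn Arr.src N := hi₁.mono fun a h => h.2.1
  obtain ⟨C, hCo, hCc, hgC, hCN⟩ := exists_isOpen_isCompact_subset (hs.isOpenMap N hN)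
    (Set.mem_image_of_mem _ ⟨hg, hg₁, hg₂⟩)
  have hemb : IsOpenEmbedding (N.domRestrict (Arr.src : Arr 𝒢 → 𝒢)) :=
    .of_continuous_injective_isOpenMap (hs.continuous.comp continuous_subtype_val)
      hiN.injective (hs.isOpenMap.comp hN.isOpenMap_subtype_val)
  refine ⟨N ∩ Arr.src ⁻¹' C, ⟨hN.inter (hCo.preimage hs.continuous), ?_, hiN.mono fun a h => h.1,
    hi₂.mono fun a h => h.1.2.2⟩, ⟨⟨hg, hg₁, hg₂⟩, hgC⟩, fun a h => h.1.1⟩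
  -- On `N` the source map is an open embedding whose image contains `C`, so compactness of `C`
  -- lifts to `N`.
  have h1 : IsCompact (N.domRestrict (Arr.src : Arr 𝒢 → 𝒢) ⁻¹' C) := by
    refine hemb.isInducing.isCompact_preimage' hCc ?_
    rintro x hx
    obtain ⟨a, ha, rfl⟩ := hCN hx
    exact ⟨⟨a, ha⟩, rfl⟩
  convert h1.image continuous_subtype_val using 1
  ext a
  constructor
  · rintro ⟨h, h'⟩
    exact ⟨⟨a, h⟩, h', rfl⟩
  · rintro ⟨⟨a, h⟩, h', rfl⟩
    exact ⟨h, h'⟩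

theorem continuous_unit : Continuous (Arr.unit : 𝒢 → Arr 𝒢) :=
  TopologicalGroupoid.isEmbedding_unit.continuous

theorem range_unit_eq : Set.range (Arr.unit : 𝒢 → Arr 𝒢) = {g | g = Arr.unit g.src} := by
  ext g
  constructor
  · rintro ⟨x, rfl⟩; rfl
  · intro h; exact ⟨_, h.symm⟩

/-- Units are the fixed points of the continuous map `g ↦ Arr.unit g.src`, hence closed in a
Hausdorff space. Near a unit, `g` and its image both lie in a set on which the source is injective;
having the same source they agree, which gives openness. -/
theorem isClopen_range_unit : IsClopen (Set.range (Arr.unit : 𝒢 → Arr 𝒢)) := by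
  have : T2Space (Arr 𝒢) := HausdorffAmpleGroupoid.t2Space_arr
  have hc : Continuous fun g : Arr 𝒢 => Arr.unit g.src :=
    continuous_unit.comp TopologicalGroupoid.continuous_src
  constructor
  · rw [range_unit_eq]
    exact isClosed_eq continuous_id hc
  · rw [isOpen_iff_mem_nhds]
    rintro _ ⟨x, rfl⟩
    obtain ⟨N, hN, hx, hi⟩ := exists_injOn_src (Arr.unit x)
    filter_upwards [hN.mem_nhds hx, (hN.preimage hc).mem_nhds hx] with g h1 h2
    exact ⟨g.src, hi h2 h1 rfl⟩

theorem isOpenMap_unit : IsOpenMap (Arr.unit : 𝒢 → Arr 𝒢) :=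
  (IsOpenEmbedding.mk TopologicalGroupoid.isEmbedding_unit isClopen_range_unit.2).isOpenMap

omit [HausdorffAmpleGroupoid 𝒢] in
theorem IsCompactOpenBisection.inter_isClopen {B C : Set (Arr 𝒢)} (hB : IsCompactOpenBisection B)
    (hC : IsClopen C) : IsCompactOpenBisection (B ∩ C) :=
  ⟨hB.isOpen.inter hC.2, hB.isCompact.inter_right hC.1, hB.injOn_src.mono Set.inter_subset_left,
    hB.injOn_tgt.mono Set.inter_subset_left⟩

theorem isCompactOpenBisection_unit {K : Set 𝒢} (hK : IsOpen K) (hK' : IsCompact K) :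
    IsCompactOpenBisection (Arr.unit '' K : Set (Arr 𝒢)) where
  isOpen := isOpenMap_unit _ hK
  isCompact := hK'.image continuous_unit
  injOn_src := by
    rintro _ ⟨x, -, rfl⟩ _ ⟨y, -, rfl⟩ (rfl : x = y)
    rfl
  injOn_tgt := by
    rintro _ ⟨x, -, rfl⟩ _ ⟨y, -, rfl⟩ (rfl : x = y)
    rfl

end Topology

/-! ### The Steinberg algebra as locally constant functions of compact support -/

section Span

variable {R : Type w} [CommRing R] {𝒢 : Type u} [Groupoid.{v} 𝒢] [TopologicalSpace 𝒢]
  [TopologicalSpace (Arr 𝒢)]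

theorem IsCompactOpenBisection.charFn_mem {B : Set (Arr 𝒢)} (hB : IsCompactOpenBisection B) :
    charFn R B ∈ steinbergSpan R 𝒢 := Submodule.subset_span ⟨B, hB, rfl⟩

variable [HausdorffAmpleGroupoid 𝒢]

/-- In a Hausdorff arrow space a compact open bisection is also closed, so its characteristic
function does not jump on its boundary. -/
theorem isLocallyConstant_of_mem {f : Arr 𝒢 → R} (hf : f ∈ steinbergSpan R 𝒢) :
    IsLocallyConstant f := by
  have : T2Space (Arr 𝒢) := HausdorffAmpleGroupoid.t2Space_arr
  induction hf using Submodule.span_induction with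
  | mem f hf =>
    obtain ⟨U, hU, rfl⟩ := hf
    rw [IsLocallyConstant.iff_eventually_eq]
    intro g
    by_cases hg : g ∈ U
    · filter_upwards [hU.isOpen.mem_nhds hg] with h hh
      simp [charFn, hg, hh]
    · filter_upwards [hU.isCompact.isClosed.isOpen_compl.mem_nhds hg] with h hh
      rw [Set.mem_compl_iff] at hh
      simp [charFn, hg, hh]
  | zero => exact IsLocallyConstant.const (0 : R)
  | add f g _ _ hf hg => exact hf.add hg
  | smul r f _ hf => exact hf.comp (r • ·)

theorem exists_isCompact_support_subset {f : Arr 𝒢 → R} (hf : f ∈ steinbergSpan R 𝒢) :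
    ∃ K, IsCompact K ∧ Function.support f ⊆ K := by
  induction hf using Submodule.span_induction with
  | mem f hf =>
    obtain ⟨U, hU, rfl⟩ := hf
    exact ⟨U, hU.isCompact, Set.support_indicator_subset⟩
  | zero => exact ⟨∅, isCompact_empty, by simp⟩
  | add f g _ _ hf hg =>
    obtain ⟨K, hK, hfK⟩ := hf
    obtain ⟨L, hL, hgL⟩ := hg
    exact ⟨K ∪ L, hK.union hL,
      (Function.support_add f g).trans (Set.union_subset_union hfK hgL)⟩
  | smul r f _ hf =>
    obtain ⟨K, hK, hfK⟩ := hf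
    exact ⟨K, hK, (Function.support_const_smul_subset r f).trans hfK⟩

/-- Locally constant functions of compact support belong to the Steinberg algebra. -/
theorem mem_steinbergSpan {f : Arr 𝒢 → R} (hf : IsLocallyConstant f) {K : Set (Arr 𝒢)}
    (hK : IsCompact K) (hfK : Function.support f ⊆ K) : f ∈ steinbergSpan R 𝒢 := by
  have : T2Space (Arr 𝒢) := HausdorffAmpleGroupoid.t2Space_arr
  -- The claim covers all clopen `C ⊆ L` so that it survives unions: a clopen subset of `L ∪ M`
  -- splits disjointly into `C ∩ L` and `C \ L`. At the end `C` is the support of `f`.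
  obtain ⟨L, -, hKL, hL⟩ : ∃ L : Set (Arr 𝒢), IsClopen L ∧ K ⊆ L ∧ ∀ C, IsClopen C → C ⊆ L →
      C.indicator f ∈ steinbergSpan R 𝒢 := by
    clear hfK
    refine hK.induction_on ?_ ?_ ?_ ?_
    · refine ⟨∅, isClopen_empty, le_rfl, fun C _ hC => ?_⟩
      rw [Set.subset_empty_iff.1 hC, Set.indicator_empty]
      exact zero_mem _
    · rintro s t hst ⟨L, hLc, htL, hL⟩
      exact ⟨L, hLc, hst.trans htL, hL⟩
    · rintro s t ⟨L, hLc, hsL, hL⟩ ⟨M, hMc, htM, hM⟩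
      refine ⟨L ∪ M, hLc.union hMc, Set.union_subset_union hsL htM, fun C hC hCLM => ?_⟩
      have h1 := add_mem (hL (C ∩ L) (hC.inter hLc) Set.inter_subset_right)
        (hM (C \ L) (hC.diff hLc) (by rw [Set.sdiff_subset_iff]; exact hCLM))
      convert h1 using 1
      funext g
      by_cases hg : g ∈ C <;> by_cases hg' : g ∈ L <;> simp [hg, hg']
    · intro x _
      obtain ⟨B, hB, hxB, hBf⟩ := exists_bisection (hf.isOpen_fiber (f x)) (g := x) rfl
      refine ⟨B, mem_nhdsWithin_of_mem_nhds (hB.isOpen.mem_nhds hxB), B,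
        ⟨hB.isCompact.isClosed, hB.isOpen⟩, le_rfl, fun C hC hCB => ?_⟩
      have hC' : IsCompactOpenBisection C := by
        have := hB.inter_isClopen hC
        rwa [Set.inter_eq_self_of_subset_right hCB] at this
      convert Submodule.smul_mem _ (f x) (hC'.charFn_mem (R := R)) using 1
      funext g
      by_cases hg : g ∈ C
      · simpa [charFn, hg] using hBf (hCB hg)
      · simp [charFn, hg]
  have := hL (Function.support f) (hf.isClopen_fiber 0).compl (hfK.trans hKL)
  rwa [Set.indicator_support] at this

/-- Local constancy and compact support only need `h 0 = 0`, not additivity. This serves for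
reduction modulo `p`, for lifting residues and for division by `p`. -/
theorem comp_mem {S : Type*} [CommRing S] {f : Arr 𝒢 → R} (hf : f ∈ steinbergSpan R 𝒢) (h : R → S)
    (h0 : h 0 = 0) : h ∘ f ∈ steinbergSpan S 𝒢 := by
  obtain ⟨K, hK, hfK⟩ := exists_isCompact_support_subset hf
  exact mem_steinbergSpan ((isLocallyConstant_of_mem hf).comp h) hK
    ((Function.support_comp_subset h0 f).trans hfK)

end Span

/-! ### Right convolution by bisections, and cutting down by sets of units -/

section RightConv

variable {R : Type w} [CommRing R] {𝒢 : Type u} [Groupoid.{v} 𝒢]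

theorem conv_charFn_right_of_mem {U : Set (Arr 𝒢)} (hU : Set.InjOn Arr.src U) (f : Arr 𝒢 → R)
    {x y z : 𝒢} (a : x ⟶ y) (k : x ⟶ z) (hk : (⟨x, z, k⟩ : Arr 𝒢) ∈ U) :
    conv f (charFn R U) ⟨x, y, a⟩ = f ⟨z, y, inv k ≫ a⟩ := by
  unfold conv
  rw [finsum_eq_single _ (⟨z, k⟩ : Σ z : 𝒢, (x ⟶ z))]
  · simp [charFn, hk]
  · rintro ⟨z', h⟩ hne
    have h2 : (⟨x, z', h⟩ : Arr 𝒢) ∉ U := by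
      intro hmem
      have h3 := hU hmem hk rfl
      apply hne
      cases h3
      rfl
    simp [charFn, h2]

theorem conv_charFn_right_of_notMem {U : Set (Arr 𝒢)} (f : Arr 𝒢 → R) {x y : 𝒢} (a : x ⟶ y)
    (hn : ¬ ∃ (z : 𝒢) (k : x ⟶ z), (⟨x, z, k⟩ : Arr 𝒢) ∈ U) :
    conv f (charFn R U) ⟨x, y, a⟩ = 0 := by
  unfold conv
  apply finsum_eq_zero_of_forall_eq_zero
  rintro ⟨z', h⟩
  have h2 : (⟨x, z', h⟩ : Arr 𝒢) ∉ U := fun hmem => hn ⟨_, _, hmem⟩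
  simp [charFn, h2]

theorem eq_id_of_mem_range_unit {x y : 𝒢} {a : x ⟶ y}
    (h : (⟨x, y, a⟩ : Arr 𝒢) ∈ Set.range (Arr.unit : 𝒢 → Arr 𝒢)) :
    (⟨x, y, a⟩ : Arr 𝒢) = Arr.unit x ∧ (⟨x, y, a⟩ : Arr 𝒢) = Arr.unit y := by
  obtain ⟨z, hz⟩ := h
  cases hz
  exact ⟨rfl, rfl⟩

open Classical in
-- Translation by units is trivial, so only a restriction of the range remains. With the right-hand
-- version it cuts a function down to the arrows with both ends in `S`.
theorem conv_charFn_unit_left {S : Set (Arr 𝒢)} (hS : S ⊆ Set.range Arr.unit) (f : Arr 𝒢 → R)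
    (g : Arr 𝒢) : conv (charFn R S) f g = if Arr.unit g.tgt ∈ S then f g else 0 := by
  obtain ⟨x, y, a⟩ := g
  split_ifs with h
  · rw [conv_charFn_of_mem ?_ f a (𝟙 y) h]
    · simp
    · rintro a ha b hb e
      obtain ⟨a, rfl⟩ := hS ha
      obtain ⟨b, rfl⟩ := hS hb
      exact congrArg Arr.unit e
  · apply conv_charFn_of_notMem
    rintro ⟨z, k, hk⟩
    exact h ((eq_id_of_mem_range_unit (hS hk)).2 ▸ hk)

open Classical in
theorem conv_charFn_unit_right {S : Set (Arr 𝒢)} (hS : S ⊆ Set.range Arr.unit) (f : Arr 𝒢 → R)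
    (g : Arr 𝒢) : conv f (charFn R S) g = if Arr.unit g.src ∈ S then f g else 0 := by
  obtain ⟨x, y, a⟩ := g
  split_ifs with h
  · rw [conv_charFn_right_of_mem ?_ f a (𝟙 x) h]
    · simp
    · rintro a ha b hb e
      obtain ⟨a, rfl⟩ := hS ha
      obtain ⟨b, rfl⟩ := hS hb
      exact congrArg Arr.unit e
  · apply conv_charFn_right_of_notMem
    rintro ⟨z, k, hk⟩
    exact h ((eq_id_of_mem_range_unit (hS hk)).1 ▸ hk)

theorem charFn_of_mem {S : Set (Arr 𝒢)} {g : Arr 𝒢} (h : g ∈ S) : charFn R S g = 1 := by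
  simp [charFn, h]

theorem charFn_of_notMem {S : Set (Arr 𝒢)} {g : Arr 𝒢} (h : g ∉ S) : charFn R S g = 0 := by
  simp [charFn, h]

end RightConv

/-! ### Ideals of the Steinberg algebra -/

section Ideals

variable {R : Type w} [CommRing R] {𝒢 : Type u} [Groupoid.{v} 𝒢] [TopologicalSpace 𝒢]
  [TopologicalSpace (Arr 𝒢)] [HausdorffAmpleGroupoid 𝒢]

variable (R) in
/-- The characteristic function of a compact open bisection, as an element of the Steinberg
algebra. -/
noncomputable def charElt {B : Set (Arr 𝒢)} (hB : IsCompactOpenBisection B) :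
    SteinbergAlgebra R 𝒢 := ⟨charFn R B, hB.charFn_mem⟩

theorem steinberg_induction {P : SteinbergAlgebra R 𝒢 → Prop}
    (char : ∀ (B : Set (Arr 𝒢)) (hB : IsCompactOpenBisection B), P (charElt R hB))
    (zero : P 0) (add : ∀ f g, P f → P g → P (f + g)) (smul : ∀ (r : R) f, P f → P (r • f))
    (f : SteinbergAlgebra R 𝒢) : P f := by
  obtain ⟨f, hf⟩ := f
  induction hf using Submodule.span_induction with
  | mem f hf =>
    obtain ⟨U, hU, rfl⟩ := hf
    exact char U hU
  | zero => exact zero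
  | add f g hf hg h1 h2 => exact add ⟨f, hf⟩ ⟨g, hg⟩ h1 h2
  | smul r f hf h => exact smul r ⟨f, hf⟩ h

/-- A submodule that is stable under multiplication by characteristic functions is an ideal. -/
noncomputable def idealOfSubmodule (P : Submodule R (SteinbergAlgebra R 𝒢))
    (left : ∀ (B : Set (Arr 𝒢)) (hB : IsCompactOpenBisection B), ∀ f ∈ P, charElt R hB * f ∈ P)
    (right : ∀ (B : Set (Arr 𝒢)) (hB : IsCompactOpenBisection B), ∀ f ∈ P, f * charElt R hB ∈ P) :
    TwoSidedIdeal (SteinbergAlgebra R 𝒢) :=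
  .mk' P P.zero_mem P.add_mem P.neg_mem
    (by
      intro a f hf
      induction a using steinberg_induction with
      | char B hB => exact left B hB f hf
      | zero => rw [zero_mul]; exact P.zero_mem
      | add a b ha hb => rw [add_mul]; exact P.add_mem ha hb
      | smul r a ha => rw [smul_mul_assoc]; exact P.smul_mem r ha)
    (by
      intro f a hf
      induction a using steinberg_induction with
      | char B hB => exact right B hB f hf
      | zero => rw [mul_zero]; exact P.zero_mem
      | add a b ha hb => rw [mul_add]; exact P.add_mem ha hb
      | smul r a ha => rw [mul_smul_comm]; exact P.smul_mem r ha)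

theorem mem_idealOfSubmodule {P : Submodule R (SteinbergAlgebra R 𝒢)} {left right}
    {f : SteinbergAlgebra R 𝒢} : f ∈ idealOfSubmodule P left right ↔ f ∈ P := by
  rw [idealOfSubmodule, TwoSidedIdeal.mem_mk']
  rfl

theorem exists_unit_bisection {O : Set 𝒢} (hO : IsOpen O) {x : 𝒢} (hx : x ∈ O) :
    ∃ S : Set (Arr 𝒢), IsCompactOpenBisection S ∧ S ⊆ Set.range Arr.unit ∧ Arr.unit x ∈ S ∧
      ∀ g ∈ S, g.src ∈ O := by
  obtain ⟨S, hS, hxS, hSO⟩ := exists_bisection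
    (isClopen_range_unit.2.inter (hO.preimage TopologicalGroupoid.continuous_src))
    (g := Arr.unit x) ⟨⟨x, rfl⟩, hx⟩
  exact ⟨S, hS, fun g hg => (hSO hg).1, hxS, fun g hg => (hSO hg).2⟩

/-! ### Simplicity implies minimality and effectiveness -/

/-- The submodule of the functions that vanish on the arrows whose source is not in `U`. -/
def supportedOn (R : Type w) [CommRing R] (U : Set 𝒢) : Submodule R (SteinbergAlgebra R 𝒢) where
  carrier := {f | ∀ g : Arr 𝒢, g.src ∉ U → f.1 g = 0}
  zero_mem' _ _ := rfl
  add_mem' ha hb g hg := (congrArg₂ (· + ·) (ha g hg) (hb g hg)).trans (add_zero 0)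
  smul_mem' r _ ha g hg := (congrArg (r * ·) (ha g hg)).trans (mul_zero r)

/-- For an invariant open `U`, the functions supported over `U` form an ideal: left translation
keeps sources, and right translation moves them within an orbit. The ideal contains `χ_S` for small
sets `S` of units in `U`, and no `χ_S` with a unit outside `U`. -/
theorem isMinimal_of_isSimpleRing [Nontrivial R] (h : IsSimpleRing (SteinbergAlgebra R 𝒢)) :
    IsMinimal 𝒢 := by
  intro U hU hinv
  let I : TwoSidedIdeal (SteinbergAlgebra R 𝒢) := idealOfSubmodule (supportedOn R U)
    (by
      rintro B hB f hf ⟨x, y, a⟩ hg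
      change conv (charFn R B) f.1 _ = 0
      by_cases hn : ∃ (z : 𝒢) (k : z ⟶ y), (⟨z, y, k⟩ : Arr 𝒢) ∈ B
      · obtain ⟨z, k, hk⟩ := hn
        rw [conv_charFn_of_mem hB.injOn_tgt _ a k hk]
        exact hf _ hg
      · exact conv_charFn_of_notMem _ a hn)
    (by
      rintro B hB f hf ⟨x, y, a⟩ hg
      change conv f.1 (charFn R B) _ = 0
      by_cases hn : ∃ (z : 𝒢) (k : x ⟶ z), (⟨x, z, k⟩ : Arr 𝒢) ∈ B
      · obtain ⟨z, k, hk⟩ := hn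
        rw [conv_charFn_right_of_mem hB.injOn_src _ a k hk]
        exact hf _ fun hz => hg (hinv ⟨z, x, inv k⟩ hz)
      · exact conv_charFn_right_of_notMem _ a hn)
  rcases h.simple.eq_bot_or_eq_top I with hI | hI
  · left
    by_contra hne
    obtain ⟨x, hx⟩ := Set.nonempty_iff_ne_empty.2 hne
    obtain ⟨S, hS, -, hxS, hSU⟩ := exists_unit_bisection hU hx
    have h1 : charElt R hS ∈ I :=
      mem_idealOfSubmodule.2 fun g hg => charFn_of_notMem fun hgS => hg (hSU g hgS)
    rw [hI, TwoSidedIdeal.mem_bot] at h1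
    have h2 : charFn R S (Arr.unit x) = 0 := congrFun (congrArg Subtype.val h1) _
    rw [charFn_of_mem hxS] at h2
    exact one_ne_zero h2
  · right
    rw [Set.eq_univ_iff_forall]
    intro x
    by_contra hx
    obtain ⟨S, hS, -, hxS, -⟩ := exists_unit_bisection isOpen_univ (Set.mem_univ x)
    have h1 : charElt R hS ∈ I := by rw [hI]; trivial
    have h2 : charFn R S (Arr.unit x) = 0 := mem_idealOfSubmodule.1 h1 _ hx
    rw [charFn_of_mem hxS] at h2
    exact one_ne_zero h2

theorem finite_support_hom {f : Arr 𝒢 → R} (hf : FinTgt f) (x y : 𝒢) :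
    (Function.support fun a : x ⟶ y => f ⟨x, y, a⟩).Finite := by
  have inj : Function.Injective (fun a : x ⟶ y => (⟨x, y, a⟩ : Arr 𝒢)) := by
    intro a b e
    cases e
    rfl
  exact ((hf y).preimage inj.injOn).subset fun a ha => ⟨rfl, ha⟩

/-- The kernel of the representation of the Steinberg algebra on functions on the unit space. -/
noncomputable def orbitKernel (R : Type w) [CommRing R] (𝒢 : Type u) [Groupoid.{v} 𝒢]
    [TopologicalSpace (Arr 𝒢)] [TopologicalSpace 𝒢] [HausdorffAmpleGroupoid 𝒢] :
    Submodule R (SteinbergAlgebra R 𝒢) where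
  carrier := {f | ∀ x y : 𝒢, ∑ᶠ a : x ⟶ y, f.1 ⟨x, y, a⟩ = 0}
  zero_mem' _ _ := finsum_zero
  add_mem' {a b} ha hb x y := by
    refine (finsum_add_distrib (finite_support_hom (.of_mem a.2) x y)
      (finite_support_hom (.of_mem b.2) x y)).trans ?_
    rw [ha, hb, add_zero]
  smul_mem' r a ha x y := by
    refine (mul_finsum' _ r (finite_support_hom (.of_mem a.2) x y)).symm.trans ?_
    rw [ha, mul_zero]

/-- If a non-unit arrow is interior to the isotropy, it lies in a bisection `B` of non-unit isotropy
arrows. Then `χ_B - χ_{s(B)}` is a nonzero element of the orbit kernel, while `χ_B` is not in that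
kernel, so the kernel is a proper nonzero ideal. -/
theorem isEffective_of_isSimpleRing [Nontrivial R] (h : IsSimpleRing (SteinbergAlgebra R 𝒢)) :
    IsEffective 𝒢 := by
  apply subset_antisymm
  swap
  · refine interior_maximal ?_ isClopen_range_unit.2
    rintro _ ⟨x, rfl⟩
    rfl
  intro g₀ hg₀
  by_contra hu
  obtain ⟨B, hB, hgB, hBO⟩ := exists_bisection
    (isOpen_interior.inter isClopen_range_unit.compl.2) (g := g₀) ⟨hg₀, hu⟩
  have hiso : B ⊆ {g | g.src = g.tgt} := fun b hb => interior_subset (hBO hb).1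
  have hS : IsCompactOpenBisection (Arr.unit '' (Arr.src '' B) : Set (Arr 𝒢)) :=
    isCompactOpenBisection_unit (isLocalHomeomorph_src.isOpenMap _ hB.isOpen)
      (hB.isCompact.image TopologicalGroupoid.continuous_src)
  have hgS : g₀ ∉ (Arr.unit '' (Arr.src '' B) : Set (Arr 𝒢)) := by
    rintro ⟨x, -, hx⟩
    exact hu ⟨x, hx⟩
  let I : TwoSidedIdeal (SteinbergAlgebra R 𝒢) := idealOfSubmodule (orbitKernel R 𝒢)
    (by
      rintro B hB f hf x y
      change ∑ᶠ a : x ⟶ y, conv (charFn R B) f.1 ⟨x, y, a⟩ = 0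
      by_cases hn : ∃ (z : 𝒢) (k : z ⟶ y), (⟨z, y, k⟩ : Arr 𝒢) ∈ B
      · obtain ⟨z, k, hk⟩ := hn
        rw [← hf x z]
        -- Translation by the single arrow of `B` with range `y` is a bijection of hom-sets, so sums
        -- over hom-sets are merely reindexed.
        refine finsum_eq_of_bijective (fun a : x ⟶ y => a ≫ inv k) ?_ fun a =>
          conv_charFn_of_mem hB.injOn_tgt _ a k hk
        exact Function.bijective_iff_has_inverse.2
          ⟨fun b => b ≫ k, fun a => by simp, fun a => by simp⟩
      · exact finsum_eq_zero_of_forall_eq_zero fun a => conv_charFn_of_notMem _ a hn)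
    (by
      rintro B hB f hf x y
      change ∑ᶠ a : x ⟶ y, conv f.1 (charFn R B) ⟨x, y, a⟩ = 0
      by_cases hn : ∃ (z : 𝒢) (k : x ⟶ z), (⟨x, z, k⟩ : Arr 𝒢) ∈ B
      · obtain ⟨z, k, hk⟩ := hn
        rw [← hf z y]
        refine finsum_eq_of_bijective (fun a : x ⟶ y => inv k ≫ a) ?_ fun a =>
          conv_charFn_right_of_mem hB.injOn_src _ a k hk
        exact Function.bijective_iff_has_inverse.2
          ⟨fun b => k ≫ b, fun a => by simp, fun a => by simp⟩
      · exact finsum_eq_zero_of_forall_eq_zero fun a => conv_charFn_right_of_notMem _ a hn)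
  -- At most one arrow of `B` starts at `x`, and it is a loop. Both sums are `1` if that loop exists
  -- and `x = y`, and `0` otherwise.
  have hsum : ∀ x y : 𝒢, ∑ᶠ a : x ⟶ y, charFn R B ⟨x, y, a⟩ =
      ∑ᶠ a : x ⟶ y, charFn R (Arr.unit '' (Arr.src '' B)) ⟨x, y, a⟩ := by
    intro x y
    by_cases hx : ∃ b : x ⟶ y, (⟨x, y, b⟩ : Arr 𝒢) ∈ B
    · obtain ⟨b, hb⟩ := hx
      obtain rfl : x = y := hiso hb
      rw [finsum_eq_single _ b, finsum_eq_single _ (𝟙 x), charFn_of_mem hb, charFn_of_mem]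
      · exact ⟨x, ⟨_, hb, rfl⟩, rfl⟩
      · intro c hc
        apply charFn_of_notMem
        rintro ⟨z, -, hz⟩
        cases hz
        exact hc rfl
      · intro c hc
        apply charFn_of_notMem
        intro h'
        cases hB.injOn_src h' hb rfl
        exact hc rfl
    · rw [finsum_eq_zero_of_forall_eq_zero, finsum_eq_zero_of_forall_eq_zero]
      · intro a
        apply charFn_of_notMem
        rintro ⟨z, ⟨⟨x', y', b⟩, hb, e⟩, hz⟩
        obtain rfl : x' = y' := hiso hb
        obtain rfl : x' = z := e
        cases hz
        exact hx ⟨b, hb⟩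
      · exact fun a => charFn_of_notMem fun h' => hx ⟨a, h'⟩
  have hd : charElt R hB - charElt R hS ∈ I := by
    refine mem_idealOfSubmodule.2 fun x y => ?_
    refine (finsum_sub_distrib (f := fun a : x ⟶ y => charFn R B ⟨x, y, a⟩)
      (g := fun a : x ⟶ y => charFn R (Arr.unit '' (Arr.src '' B)) ⟨x, y, a⟩) (finite_support_hom (.of_mem hB.charFn_mem) x y)
      (finite_support_hom (.of_mem hS.charFn_mem) x y)).trans ?_
    exact sub_eq_zero.2 (hsum x y)
  rcases h.simple.eq_bot_or_eq_top I with hI | hI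
  · rw [hI, TwoSidedIdeal.mem_bot, sub_eq_zero] at hd
    have h2 : charFn R B g₀ = charFn R (Arr.unit '' (Arr.src '' B)) g₀ :=
      congrFun (congrArg Subtype.val hd) _
    rw [charFn_of_mem hgB, charFn_of_notMem hgS] at h2
    exact one_ne_zero h2
  · have h1 : charElt R hB ∈ I := by rw [hI]; trivial
    have h2 : ∑ᶠ a : g₀.src ⟶ g₀.tgt, charFn R B ⟨g₀.src, g₀.tgt, a⟩ = 0 :=
      mem_idealOfSubmodule.1 h1 _ _
    rw [finsum_eq_single _ g₀.hom, charFn_of_mem hgB] at h2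
    · exact one_ne_zero h2
    · intro c hc
      apply charFn_of_notMem
      intro h'
      have := hB.injOn_src h' hgB rfl
      obtain ⟨x, y, g⟩ := g₀
      cases this
      exact hc rfl

end Ideals

/-! ### Effectiveness and minimality imply simplicity -/

section Simple

variable {𝒢 : Type u} [Groupoid.{v} 𝒢] [TopologicalSpace 𝒢] [TopologicalSpace (Arr 𝒢)]
  [HausdorffAmpleGroupoid 𝒢]

/-- Let `B'` be the non-unit arrows of `B` with both ends in `U`. If all are loops, effectiveness
makes `B'` empty and `V = U` works. Otherwise some arrow has distinct ends, separated by `O₁` and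
`O₂`; take for `V` the sources of the arrows of `B'` from `O₁` to `O₂`. An arrow of `B` starting in
`V` then ends in `O₂`, hence outside `V ⊆ O₁`. -/
theorem IsEffective.exists_isOpen_bisection (hE : IsEffective 𝒢) {B : Set (Arr 𝒢)}
    (hB : IsCompactOpenBisection B) {U : Set 𝒢} (hU : IsOpen U) (hne : U.Nonempty) :
    ∃ V ⊆ U, IsOpen V ∧ V.Nonempty ∧
      ∀ g ∈ B, g.src ∈ V → g.tgt ∈ V → g ∈ Set.range Arr.unit := by
  have := t2Space_units (𝒢 := 𝒢)
  have hs : Continuous (Arr.src : Arr 𝒢 → 𝒢) := TopologicalGroupoid.continuous_src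
  have ht : Continuous (Arr.tgt : Arr 𝒢 → 𝒢) := TopologicalGroupoid.continuous_tgt
  let B' : Set (Arr 𝒢) := (B \ Set.range Arr.unit) ∩ (Arr.src ⁻¹' U ∩ Arr.tgt ⁻¹' U)
  have hB' : IsOpen B' := (hB.isOpen.sdiff isClopen_range_unit.1).inter
    ((hU.preimage hs).inter (hU.preimage ht))
  by_cases hiso : B' ⊆ {g | g.src = g.tgt}
  · refine ⟨U, le_rfl, hU, hne, fun g hg hgs hgt => ?_⟩
    by_contra hgu
    have h1 := interior_maximal hiso hB' ⟨⟨hg, hgu⟩, hgs, hgt⟩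
    rw [IsEffective] at hE
    exact hgu (hE ▸ h1)
  · obtain ⟨g, hg, hgne⟩ := Set.not_subset.1 hiso
    obtain ⟨O₁, O₂, hO₁, hO₂, h1, h2, hd⟩ := t2_separation hgne
    refine ⟨Arr.src '' (B' ∩ (Arr.src ⁻¹' O₁ ∩ Arr.tgt ⁻¹' O₂)), ?_,
      isLocalHomeomorph_src.isOpenMap _ (hB'.inter ((hO₁.preimage hs).inter (hO₂.preimage ht))),
      ⟨_, g, ⟨hg, h1, h2⟩, rfl⟩, ?_⟩
    · rintro _ ⟨k, hk, rfl⟩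
      exact hk.1.2.1
    · rintro h hh ⟨k, hk, e⟩ ⟨l, hl, e'⟩
      obtain rfl := hB.injOn_src hk.1.1.1 hh e
      have hl1 : l.src ∈ O₁ := hl.2.1
      rw [e'] at hl1
      exact (Set.disjoint_left.1 hd hl1 hk.2.2).elim

variable {R : Type w} [CommRing R]

/-- The property of `V` passes to smaller sets, so a sum is handled by shrinking twice; for this `U`
must vary in the induction. -/
theorem IsEffective.exists_isOpen (hE : IsEffective 𝒢) {f : Arr 𝒢 → R}
    (hf : f ∈ steinbergSpan R 𝒢) {U : Set 𝒢} (hU : IsOpen U) (hne : U.Nonempty) :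
    ∃ V ⊆ U, IsOpen V ∧ V.Nonempty ∧
      ∀ g, g.src ∈ V → g.tgt ∈ V → g ∉ Set.range Arr.unit → f g = 0 := by
  induction hf using Submodule.span_induction generalizing U with
  | mem f hf =>
    obtain ⟨B, hB, rfl⟩ := hf
    obtain ⟨V, hVU, hV, hVne, h⟩ := hE.exists_isOpen_bisection hB hU hne
    exact ⟨V, hVU, hV, hVne, fun g h1 h2 h3 => charFn_of_notMem fun hg => h3 (h g hg h1 h2)⟩
  | zero => exact ⟨U, le_rfl, hU, hne, fun _ _ _ _ => rfl⟩
  | add f f' _ _ hf hf' =>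
    obtain ⟨V, hVU, hV, hVne, h⟩ := hf hU hne
    obtain ⟨W, hWV, hW, hWne, h'⟩ := hf' hV hVne
    refine ⟨W, hWV.trans hVU, hW, hWne, fun g h1 h2 h3 => ?_⟩
    rw [Pi.add_apply, h g (hWV h1) (hWV h2) h3, h' g h1 h2 h3, add_zero]
  | smul r f _ hf =>
    obtain ⟨V, hVU, hV, hVne, h⟩ := hf hU hne
    refine ⟨V, hVU, hV, hVne, fun g h1 h2 h3 => ?_⟩
    rw [Pi.smul_apply, h g h1 h2 h3, smul_zero]

theorem eq_unit_src_of_mem_range {g : Arr 𝒢} (hg : g ∈ Set.range Arr.unit) :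
    Arr.unit g.src = g ∧ Arr.unit g.tgt = g := by
  obtain ⟨x, rfl⟩ := hg
  exact ⟨rfl, rfl⟩

/-- Every nonzero ideal of the Steinberg algebra over a field of an effective groupoid contains the
characteristic function of a nonempty set of units. -/
theorem IsEffective.exists_charElt_mem {K : Type w} [Field K] (hE : IsEffective 𝒢)
    (I : TwoSidedIdeal (SteinbergAlgebra K 𝒢)) {f : SteinbergAlgebra K 𝒢} (hf : f ∈ I)
    (h0 : f ≠ 0) : ∃ (x : 𝒢) (S : Set (Arr 𝒢)) (hS : IsCompactOpenBisection S),
      S ⊆ Set.range Arr.unit ∧ Arr.unit x ∈ S ∧ charElt K hS ∈ I := by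
  obtain ⟨⟨x, y, a⟩, ha⟩ : ∃ g, f.1 g ≠ 0 := by
    by_contra! hn
    exact h0 (Subtype.ext (funext hn))
  obtain ⟨B, hB, haB, -⟩ := exists_bisection isOpen_univ (Set.mem_univ (⟨x, y, a⟩ : Arr 𝒢))
  -- Translating by `B⁻¹` carries the nonzero value at `a` to the unit at its source.
  set b := charElt K hB.inv * f with hb
  have hbI : b ∈ I := I.mul_mem_left _ _ hf
  have hbx : b.1 (Arr.unit x) = f.1 ⟨x, y, a⟩ := by
    have haB' : (⟨y, x, inv a⟩ : Arr 𝒢) ∈ Arr.inv ⁻¹' B := by simpa [Arr.inv] using haB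
    refine (conv_charFn_of_mem hB.inv.injOn_tgt f.1 (𝟙 x) (inv a) haB').trans ?_
    simp
  set c := f.1 ⟨x, y, a⟩
  -- Start from the open set of units where `b` takes the value `c`, and shrink it until `b`
  -- vanishes on the non-unit arrows within `V`.
  obtain ⟨V, hVO, hV, ⟨v, hv⟩, hVb⟩ := hE.exists_isOpen b.2
    (((isLocallyConstant_of_mem b.2).isOpen_fiber c).preimage continuous_unit) ⟨x, hbx⟩
  obtain ⟨S, hS, hSu, hvS, hSV⟩ := exists_unit_bisection hV hv
  refine ⟨v, S, hS, hSu, hvS, ?_⟩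
  -- Cut down to `S`, the element `b` equals `c χ_S`; so this product is `χ_S`.
  have h1 : (c⁻¹ • charElt K hS) * b * charElt K hS ∈ I :=
    I.mul_mem_right _ _ (I.mul_mem_left _ _ hbI)
  convert h1 using 1
  rw [smul_mul_assoc, smul_mul_assoc]
  apply Subtype.ext
  funext g
  change charFn K S g = c⁻¹ * conv (conv (charFn K S) b.1) (charFn K S) g
  rw [conv_charFn_unit_right hSu, conv_charFn_unit_left hSu]
  by_cases hg : g ∈ Set.range Arr.unit
  · obtain ⟨e1, e2⟩ := eq_unit_src_of_mem_range hg
    rw [e1, e2]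
    by_cases hgS : g ∈ S
    · have h2 : b.1 (Arr.unit g.src) = c := hVO (hSV g hgS)
      rw [e1] at h2
      rw [if_pos hgS, if_pos hgS, h2, charFn_of_mem hgS, inv_mul_cancel₀ ha]
    · rw [if_neg hgS, charFn_of_notMem hgS, mul_zero]
  · rw [charFn_of_notMem fun h => hg (hSu h)]
    split_ifs with h2 h3
    · rw [hVb g (hSV (Arr.unit g.src) h2) (hSV (Arr.unit g.tgt) h3) hg, mul_zero]
    · rw [mul_zero]
    · rw [mul_zero]

/-- The set of units at which some characteristic function in `I` is supported is everything, as
soon as it is nonempty. -/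
theorem IsMinimal.exists_charElt_mem (hM : IsMinimal 𝒢) (I : TwoSidedIdeal (SteinbergAlgebra R 𝒢))
    (hI : ∃ (x : 𝒢) (S : Set (Arr 𝒢)) (hS : IsCompactOpenBisection S),
      S ⊆ Set.range Arr.unit ∧ Arr.unit x ∈ S ∧ charElt R hS ∈ I) (x : 𝒢) :
    ∃ (S : Set (Arr 𝒢)) (hS : IsCompactOpenBisection S),
      S ⊆ Set.range Arr.unit ∧ Arr.unit x ∈ S ∧ charElt R hS ∈ I := by
  let U : Set 𝒢 := {x | ∃ (S : Set (Arr 𝒢)) (hS : IsCompactOpenBisection S),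
      S ⊆ Set.range Arr.unit ∧ Arr.unit x ∈ S ∧ charElt R hS ∈ I}
  have hU : IsOpen U := by
    rw [isOpen_iff_mem_nhds]
    rintro x ⟨S, hS, hSu, hx, hSI⟩
    filter_upwards [(hS.isOpen.preimage continuous_unit).mem_nhds hx] with y hy
    exact ⟨S, hS, hSu, hy, hSI⟩
  have hinv : ∀ g : Arr 𝒢, g.src ∈ U → g.tgt ∈ U := by
    rintro ⟨x, y, a⟩ ⟨S, hS, hSu, hx, hSI⟩
    obtain ⟨B, hB, haB, -⟩ := exists_bisection isOpen_univ (Set.mem_univ (⟨x, y, a⟩ : Arr 𝒢))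
    -- Conjugation by a bisection `B` through the arrow: `B S B⁻¹` is a set of units containing the
    -- one at `y`, with characteristic function `χ_B χ_S χ_{B⁻¹}`.
    refine ⟨mulSet (mulSet B S) (Arr.inv ⁻¹' B), (hB.mul hS).mul hB.inv, ?_, ?_, ?_⟩
    · rintro _ ⟨_, ⟨b, hb, s, hs, e, rfl⟩, c, hc, e', rfl⟩
      obtain ⟨z, rfl⟩ := hSu hs
      obtain ⟨z', w, b⟩ := b
      obtain rfl : z' = z := e
      obtain ⟨w', z'', c⟩ := c
      obtain rfl : z' = z'' := e'
      have := hB.injOn_src hc hb rfl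
      simp only [Arr.inv, Arr.mk.injEq, true_and] at this
      obtain ⟨rfl, this⟩ := this
      have := eq_of_heq this
      subst this
      refine ⟨w', ?_⟩
      have h1 : 𝟙 w' = c ≫ 𝟙 z' ≫ 𝟙 z' ≫ 𝟙 z' ≫ inv c := by
        simp only [Category.id_comp, IsIso.hom_inv_id]
      simp only [Arr.mul, Arr.unit, Arr.mk.injEq, heq_eq_eq, true_and]
      exact h1
    · refine ⟨⟨x, y, a⟩, ⟨⟨x, y, a⟩, haB, _, hx, rfl, ?_⟩, ⟨y, x, inv a⟩, ?_, rfl, ?_⟩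
      · simp [Arr.mul, Arr.unit]
      · simpa [Arr.inv] using haB
      · simp [Arr.mul, Arr.unit]
    · have h1 : charElt R hB * charElt R hS * charElt R hB.inv ∈ I :=
        I.mul_mem_right _ _ (I.mul_mem_left _ _ hSI)
      convert h1 using 1
      apply Subtype.ext
      change _ = conv (conv (charFn R B) (charFn R S)) (charFn R (Arr.inv ⁻¹' B))
      rw [conv_charFn_charFn hB.injOn_tgt, conv_charFn_charFn (hB.mul hS).injOn_tgt]
      rfl
  rcases hM U hU hinv with h | h
  · obtain ⟨y, hy⟩ := hI
    exact absurd (show y ∈ U from hy) (h ▸ Set.notMem_empty y)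
  · exact (h ▸ Set.mem_univ x : x ∈ U)

/-- By compactness one set `S` of units with `χ_S` in `I` covers the sources of `B`, and then `χ_B =
χ_B χ_S`. The scalar `r` is absorbed into the left factor, since a ring ideal is not assumed stable
under `R`. -/
theorem charElt_mem_of_forall (I : TwoSidedIdeal (SteinbergAlgebra R 𝒢))
    (hI : ∀ x : 𝒢, ∃ (S : Set (Arr 𝒢)) (hS : IsCompactOpenBisection S),
      S ⊆ Set.range Arr.unit ∧ Arr.unit x ∈ S ∧ charElt R hS ∈ I)
    (r : R) {B : Set (Arr 𝒢)} (hB : IsCompactOpenBisection B) : r • charElt R hB ∈ I := by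
  have hT : IsCompact ((fun g : Arr 𝒢 => Arr.unit g.src) '' B) :=
    hB.isCompact.image (continuous_unit.comp TopologicalGroupoid.continuous_src)
  obtain ⟨S, hS, hSu, hBS, hSI⟩ : ∃ (S : Set (Arr 𝒢)) (hS : IsCompactOpenBisection S),
      S ⊆ Set.range Arr.unit ∧ ((fun g : Arr 𝒢 => Arr.unit g.src) '' B) ⊆ S ∧
        charElt R hS ∈ I := by
    refine hT.induction_on ?_ ?_ ?_ ?_
    · refine ⟨∅, ⟨isOpen_empty, isCompact_empty, by simp, by simp⟩, by simp, le_rfl, ?_⟩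
      convert I.zero_mem
      exact Subtype.ext (Set.indicator_empty _)
    · rintro s t hst ⟨S, hS, hSu, htS, hSI⟩
      exact ⟨S, hS, hSu, hst.trans htS, hSI⟩
    · rintro s t ⟨S, hS, hSu, hsS, hSI⟩ ⟨S', hS', hSu', htS, hSI'⟩
      have hu : S ∪ S' ⊆ Set.range Arr.unit := Set.union_subset hSu hSu'
      refine ⟨S ∪ S', ⟨hS.isOpen.union hS'.isOpen, hS.isCompact.union hS'.isCompact, ?_, ?_⟩, hu,
        Set.union_subset_union hsS htS, ?_⟩
      · intro g hg h hh e
        rw [← (eq_unit_src_of_mem_range (hu hg)).1, ← (eq_unit_src_of_mem_range (hu hh)).1, e]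
      · intro g hg h hh e
        rw [← (eq_unit_src_of_mem_range (hu hg)).2, ← (eq_unit_src_of_mem_range (hu hh)).2, e]
      -- Inclusion–exclusion: `χ_{S ∪ S'} = χ_S + χ_{S'} - χ_S χ_{S'}`.
      · convert I.sub_mem (I.add_mem hSI hSI') (I.mul_mem_right _ (charElt R hS') hSI) using 1
        apply Subtype.ext
        funext g
        change charFn R (S ∪ S') g = charFn R S g + charFn R S' g -
          conv (charFn R S) (charFn R S') g
        rw [conv_charFn_unit_left hSu]
        by_cases hg : g ∈ Set.range Arr.unit
        · rw [(eq_unit_src_of_mem_range hg).2]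
          by_cases h1 : g ∈ S <;> by_cases h2 : g ∈ S' <;> simp [charFn, h1, h2]
        · have h1 : g ∉ S := fun h => hg (hSu h)
          have h2 : g ∉ S' := fun h => hg (hSu' h)
          simp [charFn, h1, h2]
    · rintro _ ⟨g, -, rfl⟩
      obtain ⟨S, hS, hSu, hx, hSI⟩ := hI g.src
      exact ⟨S, mem_nhdsWithin_of_mem_nhds (hS.isOpen.mem_nhds hx), S, hS, hSu, le_rfl, hSI⟩
  convert I.mul_mem_left (r • charElt R hB) _ hSI using 1
  rw [smul_mul_assoc]
  congr 1
  apply Subtype.ext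
  funext g
  change charFn R B g = conv (charFn R B) (charFn R S) g
  rw [conv_charFn_unit_right hSu]
  split_ifs with h
  · rfl
  · exact charFn_of_notMem fun hg => h (hBS ⟨g, hg, rfl⟩)

/-- The Steinberg algebra of a Hausdorff ample groupoid over a field is simple if and only if the
groupoid is effective and minimal. -/
theorem isSimpleNonUnital_steinbergAlgebra_iff (K : Type w) [Field K] [Nonempty 𝒢] :
    IsSimpleNonUnital (SteinbergAlgebra K 𝒢) ↔ IsEffective 𝒢 ∧ IsMinimal 𝒢 := by
  refine ⟨fun h => ⟨isEffective_of_isSimpleRing h.1, isMinimal_of_isSimpleRing h.1⟩, ?_⟩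
  rintro ⟨hE, hM⟩
  obtain ⟨x⟩ := ‹Nonempty 𝒢›
  obtain ⟨S, hS, hSu, hxS, -⟩ := exists_unit_bisection isOpen_univ (Set.mem_univ x)
  have hne : charElt K hS * charElt K hS ≠ 0 := by
    intro h
    have h2 : conv (charFn K S) (charFn K S) (Arr.unit x) = 0 :=
      congrFun (congrArg Subtype.val h) _
    rw [conv_charFn_unit_left hSu, if_pos (show Arr.unit (Arr.unit x).tgt ∈ S from hxS),
      charFn_of_mem hxS] at h2
    exact one_ne_zero h2
  have : Nontrivial (TwoSidedIdeal (SteinbergAlgebra K 𝒢)) := by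
    refine ⟨⊥, ⊤, fun h => hne ?_⟩
    rw [← TwoSidedIdeal.mem_bot, h]
    trivial
  refine ⟨⟨⟨fun I => ?_⟩⟩, _, _, hne⟩
  by_cases hI : ∀ f ∈ I, f = 0
  · left
    exact le_bot_iff.1 fun f hf => (TwoSidedIdeal.mem_bot _).2 (hI f hf)
  · right
    push Not at hI
    obtain ⟨f, hf, h0⟩ := hI
    refine top_le_iff.1 fun a ha => ?_
    clear ha
    -- All scalars are carried along because the scalar step of the induction cannot use that `I` is
    -- a `K`-subspace.
    have key : ∀ r : K, r • a ∈ I := by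
      induction a using steinberg_induction with
      | char B hB =>
        exact fun r => charElt_mem_of_forall I
          (hM.exists_charElt_mem I (hE.exists_charElt_mem I hf h0)) r hB
      | zero => exact fun r => by rw [smul_zero]; exact I.zero_mem
      | add a b ha hb => exact fun r => by rw [smul_add]; exact I.add_mem (ha r) (hb r)
      | smul s a ha => exact fun r => by rw [smul_smul]; exact ha _
    simpa using key 1

end Simple

/-! ### Quotients modulo `p` -/

section Quotient

theorem IsSimpleNonUnital.congr {A B : Type*} [NonUnitalRing A] [NonUnitalRing B] (e : A ≃+* B)
    (h : IsSimpleNonUnital A) : IsSimpleNonUnital B := by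
  refine ⟨⟨?_⟩, ?_⟩
  · have := h.1.simple
    exact e.symm.mapTwoSidedIdeal.isSimpleOrder
  · obtain ⟨a, b, hab⟩ := h.2
    refine ⟨e a, e b, ?_⟩
    rwa [← map_mul, Ne, EmbeddingLike.map_eq_zero_iff]

theorem modP_mk_eq_iff {p : ℕ} {A : Type w} [NonUnitalRing A] (a b : A) :
    (a : ModP p A) = (b : ModP p A) ↔ ∃ c : A, a - b = p • c := by
  rw [RingCon.eq, TwoSidedIdeal.rel_iff, pIdeal, TwoSidedIdeal.mem_mk']
  rfl

/-- A surjective homomorphism from `A` to an `𝔽_p`-algebra with kernel `pA` induces an isomorphism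
from `A / pA`. -/
theorem exists_bijective_of_surjective {p : ℕ} {A : Type w} [NonUnitalRing A] {B : Type*}
    [NonUnitalRing B] [Module (ZMod p) B] (φ : A →ₙ+* B) (hφ : Function.Surjective φ)
    (hker : ∀ a, φ a = 0 → ∃ b, a = p • b) :
    ∃ e : ModP p A →ₙₐ[ZMod p] B, Function.Bijective e := by
  have hwd : ∀ a b : A, (pIdeal p A).ringCon a b → φ a = φ b := by
    intro a b hab
    obtain ⟨c, hc⟩ := (modP_mk_eq_iff a b).1 ((RingCon.eq _).2 hab)
    -- `B` is an `𝔽_p`-space, so `φ` automatically kills `pA`.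
    rw [← sub_eq_zero, ← map_sub, hc, map_nsmul, ← Nat.cast_smul_eq_nsmul (ZMod p),
      CharP.cast_eq_zero, zero_smul]
  let ψ : ModP p A →+ B :=
    { toFun := fun x => Quotient.liftOn' x φ hwd
      map_zero' := map_zero φ
      map_add' := fun x y => Quotient.inductionOn₂' x y fun a b => map_add φ a b }
  refine ⟨{ toFun := ψ
            map_smul' := fun c x => ZMod.map_smul ψ c x
            map_zero' := map_zero ψ
            map_add' := map_add ψ
            map_mul' := fun x y => Quotient.inductionOn₂' x y fun a b => map_mul φ a b }, ?_, ?_⟩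
  · intro x y
    refine Quotient.inductionOn₂' x y fun a b hab => ?_
    have h1 : φ (a - b) = 0 := by rw [map_sub]; exact sub_eq_zero.2 hab
    exact (modP_mk_eq_iff a b).2 (hker _ h1)
  · intro y
    obtain ⟨a, rfl⟩ := hφ y
    exact ⟨(a : ModP p A), rfl⟩

end Quotient

/-! ### Division by `p` -/

section Division

variable {p : ℕ} [Fact p.Prime]

theorem toZMod_eq_zero_iff_norm (z : ℤ_[p]) : PadicInt.toZMod z = 0 ↔ ‖z‖ < 1 := by
  rw [← RingHom.mem_ker, PadicInt.ker_toZMod, IsLocalRing.mem_maximalIdeal,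
    PadicInt.mem_nonunits]

theorem toZMod_eq_zero_iff_dvd (z : ℤ_[p]) : PadicInt.toZMod z = 0 ↔ (p : ℤ_[p]) ∣ z := by
  rw [toZMod_eq_zero_iff_norm, PadicInt.norm_lt_one_iff_dvd]

open Classical in
/-- The quotient `z / p`, when `p` divides `z`. -/
noncomputable def divP (z : ℤ_[p]) : ℤ_[p] := if h : (p : ℤ_[p]) ∣ z then h.choose else 0

theorem mul_divP {z : ℤ_[p]} (h : (p : ℤ_[p]) ∣ z) : p * divP z = z := by
  rw [divP, dif_pos h]
  exact h.choose_spec.symm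

theorem natCast_p_ne_zero : (p : ℤ_[p]) ≠ 0 :=
  Nat.cast_ne_zero.2 (Fact.out : p.Prime).ne_zero

theorem divP_zero : divP (0 : ℤ_[p]) = 0 :=
  (mul_eq_zero.1 (mul_divP (dvd_zero (p : ℤ_[p])))).resolve_left natCast_p_ne_zero

theorem norm_eq_of_p_mul (z : ℤ_[p]) : ‖z‖ = p * ‖(p : ℤ_[p]) * z‖ := by
  rw [norm_mul, PadicInt.norm_p, mul_inv_cancel_left₀]
  exact Nat.cast_ne_zero.2 (Fact.out : p.Prime).ne_zero

variable {X : Type u}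

/-- The vector `ξ / p`, when `p` divides all the entries of `ξ`. -/
noncomputable def C0.divP (ξ : C0 p X) (h : ∀ x, (p : ℤ_[p]) ∣ ξ.1 x) : C0 p X :=
  ⟨fun x => GroupoidAlg.divP (ξ.1 x), by
    have h1 : Tendsto ξ.1 cofinite (𝓝 0) := ξ.2
    have h2 := (h1.norm).const_mul (p : ℝ)
    rw [norm_zero, mul_zero] at h2
    refine tendsto_zero_iff_norm_tendsto_zero.2 (h2.congr fun x => ?_)
    rw [norm_eq_of_p_mul (GroupoidAlg.divP (ξ.1 x)), mul_divP (h x)]⟩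

theorem C0.smul_divP (ξ : C0 p X) (h : ∀ x, (p : ℤ_[p]) ∣ ξ.1 x) :
    (p : ℤ_[p]) • ξ.divP h = ξ :=
  Subtype.ext (funext fun x => mul_divP (h x))

/-- Absence of `p`-torsion: linearity of `T / p` can be checked after multiplying by `p`. -/
theorem C0.smul_p_injective {ξ η : C0 p X} (h : (p : ℤ_[p]) • ξ = (p : ℤ_[p]) • η) : ξ = η :=
  Subtype.ext (funext fun x =>
    mul_left_cancel₀ natCast_p_ne_zero (congrFun (congrArg Subtype.val h) x))

/-- The operator `T / p`, when `p` divides all the values of `T`. -/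
noncomputable def divOp (T : Module.End ℤ_[p] (C0 p X))
    (h : ∀ ξ x, (p : ℤ_[p]) ∣ (T ξ).1 x) : Module.End ℤ_[p] (C0 p X) where
  toFun ξ := (T ξ).divP (h ξ)
  map_add' ξ η := C0.smul_p_injective (by rw [smul_add]; simp only [C0.smul_divP, map_add])
  map_smul' r ξ := C0.smul_p_injective (by
    rw [smul_comm]; simp only [C0.smul_divP, map_smul, RingHom.id_apply])

theorem smul_divOp (T : Module.End ℤ_[p] (C0 p X)) (h : ∀ ξ x, (p : ℤ_[p]) ∣ (T ξ).1 x) :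
    (p : ℤ_[p]) • divOp T h = T :=
  LinearMap.ext fun ξ => (T ξ).smul_divP (h ξ)

/-- The basis vectors of `c₀(X, ℤ_p)`. -/
noncomputable def delta (x : X) : C0 p X :=
  ⟨({x} : Set X).indicator 1, by
    refine tendsto_nhds_of_eventually_eq ?_
    rw [eventually_cofinite]
    refine (Set.finite_singleton x).subset fun y hy => ?_
    by_contra hn
    exact hy (Set.indicator_of_notMem hn _)⟩

theorem pairing_delta (ξ : C0 p X) (x : X) : pairing ξ (delta x) = ξ.1 x := by
  unfold pairing
  rw [tsum_eq_single x]
  · simp [delta]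
  · intro y hy
    simp [delta, hy]

/-- The entries of the adjoint `S` are `(S ξ)(x) = ⟨S ξ, δ_x⟩ = ⟨ξ, T δ_x⟩`, hence divisible by `p`
as well, and `S / p` is adjoint to `T / p`. -/
theorem divOp_mem_adjointable {T : Module.End ℤ_[p] (C0 p X)} (hT : T ∈ adjointable p X)
    (h : ∀ ξ x, (p : ℤ_[p]) ∣ (T ξ).1 x) : divOp T h ∈ adjointable p X := by
  obtain ⟨S, hS⟩ := hT
  have hT' : ∀ ξ η, pairing ξ (T η) = p * pairing ξ (divOp T h η) := by
    intro ξ η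
    rw [← pairing_smul_right, ← LinearMap.smul_apply, smul_divOp]
  have hSp : ∀ ξ x, (p : ℤ_[p]) ∣ (S ξ).1 x := by
    intro ξ x
    rw [← pairing_delta, ← hS, hT']
    exact dvd_mul_right _ _
  refine ⟨divOp S hSp, fun ξ η => mul_left_cancel₀ natCast_p_ne_zero ?_⟩
  rw [← hT', hS, ← pairing_smul_left, ← LinearMap.smul_apply, smul_divOp]

end Division

/-! ### Reduction of `𝓞_p(𝒢)` modulo `p` -/

section Reduction

variable {p : ℕ} [Fact p.Prime] {𝒢 : Type u} [Groupoid.{v} 𝒢]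

/-- Finiteness of `f` on range fibres makes the convolution a finite sum, whatever `ξ` is. -/
theorem map_conv {R S : Type*} [CommRing R] [CommRing S] (φ : R →+* S) {f : Arr 𝒢 → R}
    (hf : FinTgt f) (ξ : Arr 𝒢 → R) (g : Arr 𝒢) :
    φ (conv f ξ g) = conv (φ ∘ f) (φ ∘ ξ) g := by
  unfold conv
  refine (AddMonoidHom.map_finsum φ.toAddMonoidHom (hf.finite_support ξ g)).trans ?_
  exact finsum_congr fun h => map_mul φ _ _

/-- Right convolution by a point mass at a unit restricts to the arrows starting there. This is why
the symbol recovers `f` from `λ(f)`. -/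
theorem conv_delta_unit (f : Arr 𝒢 → ℤ_[p]) (g : Arr 𝒢) :
    conv f (delta (Arr.unit g.src)).1 g = f g := by
  obtain ⟨x, y, a⟩ := g
  refine (conv_charFn_unit_right (S := {Arr.unit x}) ?_ f ⟨x, y, a⟩).trans (if_pos rfl)
  rintro _ rfl
  exact ⟨x, rfl⟩

/-- The symbol of an operator: the function `g ↦ (T δ_{s(g)})(g)`. -/
noncomputable def symbol (T : Module.End ℤ_[p] (C0 p (Arr 𝒢))) (g : Arr 𝒢) : ℤ_[p] :=
  (T (delta (Arr.unit g.src))).1 g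

variable [TopologicalSpace 𝒢] [TopologicalSpace (Arr 𝒢)] [HausdorffAmpleGroupoid 𝒢]

/-- The operator `T` is congruent to the left convolution by `f` modulo `p`. -/
def ApproxModP (T : Module.End ℤ_[p] (C0 p (Arr 𝒢))) (f : SteinbergAlgebra ℤ_[p] 𝒢) : Prop :=
  ∀ ξ x, PadicInt.toZMod ((T ξ).1 x) = PadicInt.toZMod (conv f.1 ξ.1 x)

theorem approxModP_of_norm_lt {T : Module.End ℤ_[p] (C0 p (Arr 𝒢))}
    {f : SteinbergAlgebra ℤ_[p] 𝒢} (h : ∀ ξ x, ‖(T ξ).1 x - (leftConv f ξ).1 x‖ < 1) :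
    ApproxModP T f := by
  intro ξ x
  rw [← sub_eq_zero, ← map_sub, toZMod_eq_zero_iff_norm]
  exact h ξ x

theorem exists_approxModP (T : padicGroupoidAlgebra p 𝒢) : ∃ f, ApproxModP T.1.1 f := by
  obtain ⟨f, hf⟩ := (exists_opNorm_sub_le_iff p 𝒢 T.1).1 T.2 (1 / 2) (by norm_num)
  exact ⟨f, approxModP_of_norm_lt fun ξ x => (hf ξ x).trans_lt (by norm_num)⟩

/-- The reduction of `f` is thus determined by `T`, and the reduced symbol inherits membership in
the Steinberg algebra from `f`. -/
theorem ApproxModP.toZMod_symbol {T : Module.End ℤ_[p] (C0 p (Arr 𝒢))}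
    {f : SteinbergAlgebra ℤ_[p] 𝒢} (h : ApproxModP T f) :
    PadicInt.toZMod ∘ symbol T = PadicInt.toZMod ∘ f.1 := by
  funext g
  exact (h _ _).trans (congrArg PadicInt.toZMod (conv_delta_unit f.1 g))

/-- Modulo `p`, convolution by `f` depends only on its argument modulo `p`, so `S ξ` may be replaced
by `g * ξ`. -/
theorem ApproxModP.mul {T S : Module.End ℤ_[p] (C0 p (Arr 𝒢))}
    {f g : SteinbergAlgebra ℤ_[p] 𝒢} (hT : ApproxModP T f) (hS : ApproxModP S g) :
    ApproxModP (T * S) (f * g) := by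
  intro ξ x
  change PadicInt.toZMod ((T (S ξ)).1 x) = PadicInt.toZMod (conv (conv f.1 g.1) ξ.1 x)
  rw [hT, conv_conv f.2 g.2, map_conv _ (.of_mem f.2), map_conv _ (.of_mem f.2)]
  exact congrArg (fun η => conv _ η x) (funext fun y => hS ξ y)

/-- The symbol tests `T` only on point masses at units, but it determines `f` modulo `p` and
therefore all values of `T` modulo `p`. -/
theorem ApproxModP.dvd_apply {T : Module.End ℤ_[p] (C0 p (Arr 𝒢))}
    {f : SteinbergAlgebra ℤ_[p] 𝒢} (h : ApproxModP T f) (h0 : PadicInt.toZMod ∘ symbol T = 0)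
    (ξ : C0 p (Arr 𝒢)) (x : Arr 𝒢) : (p : ℤ_[p]) ∣ (T ξ).1 x := by
  rw [← toZMod_eq_zero_iff_dvd, h, map_conv _ (.of_mem f.2), ← h.toZMod_symbol, h0,
    conv_zero_left]
  rfl

theorem exists_eq_smul {f : SteinbergAlgebra ℤ_[p] 𝒢} (h : PadicInt.toZMod ∘ f.1 = 0) :
    ∃ f' : SteinbergAlgebra ℤ_[p] 𝒢, f = (p : ℤ_[p]) • f' :=
  ⟨⟨divP ∘ f.1, comp_mem f.2 divP divP_zero⟩, Subtype.ext (funext fun g =>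
    (mul_divP ((toZMod_eq_zero_iff_dvd _).1 (congrFun h g))).symm)⟩

/-- The kernel of reduction is no larger than `p 𝓞_p(𝒢)`. The point is that `T / p` remains in the
closure: close approximants of `T` are divisible by `p`, and their quotients approximate `T / p`. -/
theorem exists_eq_nsmul_of_symbol_eq_zero (T : padicGroupoidAlgebra p 𝒢)
    (h0 : PadicInt.toZMod ∘ symbol T.1.1 = 0) :
    ∃ S : padicGroupoidAlgebra p 𝒢, T = p • S := by
  obtain ⟨f, hf⟩ := exists_approxModP T
  have hdvd := hf.dvd_apply h0
  refine ⟨⟨⟨divOp T.1.1 hdvd, divOp_mem_adjointable T.1.2 hdvd⟩, ?_⟩, ?_⟩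
  · refine (exists_opNorm_sub_le_iff p 𝒢 _).2 fun ε hε => ?_
    have hp : (0 : ℝ) < p := Nat.cast_pos.2 (Fact.out : p.Prime).pos
    -- The bound `1 / 2 < 1` forces `f ≡ 0` modulo `p`; the bound `ε / p` compensates for division
    -- by `p`, which multiplies norms by `p`.
    obtain ⟨f, hf⟩ := (exists_opNorm_sub_le_iff p 𝒢 T.1).1 T.2 (min (1 / 2) (ε / p))
      (lt_min (by norm_num) (div_pos hε hp))
    have happ : ApproxModP T.1.1 f := approxModP_of_norm_lt fun ξ x =>
      ((hf ξ x).trans (min_le_left _ _)).trans_lt (by norm_num)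
    obtain ⟨f', rfl⟩ := exists_eq_smul (happ.toZMod_symbol.symm.trans h0)
    refine ⟨f', fun ξ x => ?_⟩
    have h1 : (p : ℤ_[p]) * ((divOp T.1.1 hdvd ξ).1 x - (leftConv f' ξ).1 x) =
        (T.1.1 ξ).1 x - (leftConv ((p : ℤ_[p]) • f') ξ).1 x := by
      rw [leftConv_smul, mul_sub]
      exact congrArg₂ (· - ·) (mul_divP (hdvd ξ x)) rfl
    rw [norm_eq_of_p_mul, h1, ← le_div_iff₀' hp]
    exact (hf ξ x).trans (min_le_right _ _)
  · rw [← Nat.cast_smul_eq_nsmul ℤ_[p]]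
    exact Subtype.ext (Subtype.ext (smul_divOp _ _).symm)

variable (p 𝒢)

/-- The reduction modulo `p` of the algebra `𝓞_p(𝒢)`. -/
noncomputable def reduction : padicGroupoidAlgebra p 𝒢 →ₙ+* SteinbergAlgebra (ZMod p) 𝒢 where
  toFun T := ⟨PadicInt.toZMod ∘ symbol T.1.1, by
    obtain ⟨f, hf⟩ := exists_approxModP T
    rw [hf.toZMod_symbol]
    exact comp_mem f.2 _ (map_zero _)⟩
  map_zero' := Subtype.ext (funext fun _ => map_zero PadicInt.toZMod)
  map_add' _ _ := Subtype.ext (funext fun _ => map_add PadicInt.toZMod _ _)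
  map_mul' T S := by
    obtain ⟨f, hf⟩ := exists_approxModP T
    obtain ⟨g, hg⟩ := exists_approxModP S
    apply Subtype.ext
    funext x
    change (PadicInt.toZMod ∘ symbol (T.1.1 * S.1.1)) x =
      conv (PadicInt.toZMod ∘ symbol T.1.1) (PadicInt.toZMod ∘ symbol S.1.1) x
    rw [(hf.mul hg).toZMod_symbol, hf.toZMod_symbol, hg.toZMod_symbol,
      ← map_conv _ (.of_mem f.2)]
    rfl

/-- Values are lifted to their representatives `0, …, p - 1`. This lift is not additive, but it
fixes zero, which suffices for `comp_mem`. -/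
theorem reduction_surjective : Function.Surjective (reduction p 𝒢) := by
  rintro ⟨f, hf⟩
  let g : SteinbergAlgebra ℤ_[p] 𝒢 :=
    ⟨(fun z : ZMod p => (z.val : ℤ_[p])) ∘ f, comp_mem hf _ (by simp)⟩
  refine ⟨⟨regularRep p 𝒢 g, fun ε hε => ⟨g, ?_⟩⟩, Subtype.ext (funext fun x => ?_)⟩
  · refine lt_of_le_of_lt ((opNorm_le_iff _ le_rfl).2 fun ξ x => ?_) hε
    rw [sub_self]
    exact norm_zero.le
  · refine (congrArg PadicInt.toZMod (conv_delta_unit g.1 x)).trans ?_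
    exact (map_natCast _ _).trans (ZMod.natCast_zmod_val _)

theorem exists_bijective_modP : ∃ e : ModP p (padicGroupoidAlgebra p 𝒢) →ₙₐ[ZMod p]
    SteinbergAlgebra (ZMod p) 𝒢, Function.Bijective e :=
  exists_bijective_of_surjective (reduction p 𝒢) (reduction_surjective p 𝒢) fun T hT =>
    exists_eq_nsmul_of_symbol_eq_zero T (congrArg Subtype.val hT)

end Reduction

end GroupoidAlg

theorem mainTheorem7 (p : ℕ) [Fact p.Prime] (𝒢 : Type u) [CategoryTheory.Groupoid.{v} 𝒢]
    [TopologicalSpace 𝒢] [TopologicalSpace (GroupoidAlg.Arr 𝒢)]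
    [GroupoidAlg.HausdorffAmpleGroupoid 𝒢] [Nonempty 𝒢] :
    (∃ e : GroupoidAlg.ModP p (GroupoidAlg.padicGroupoidAlgebra p 𝒢) →ₙₐ[ZMod p]
        GroupoidAlg.SteinbergAlgebra (ZMod p) 𝒢, Function.Bijective e) ∧
      (GroupoidAlg.IsPSimple p (GroupoidAlg.padicGroupoidAlgebra p 𝒢) ↔
        GroupoidAlg.IsEffective 𝒢 ∧ GroupoidAlg.IsMinimal 𝒢) := by
  obtain ⟨e, he⟩ := GroupoidAlg.exists_bijective_modP p 𝒢
  refine ⟨⟨e, he⟩, ?_⟩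
  -- By the first assertion, `p`-simplicity is simplicity of `𝔽_p 𝒢`, and `𝔽_p` is a field.
  rw [← GroupoidAlg.isSimpleNonUnital_steinbergAlgebra_iff (ZMod p)]
  let E := RingEquiv.ofBijective e he
  exact ⟨fun h => h.congr E, fun h => h.congr E.symm⟩
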